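/- Consider $N$ independent arms. Arm $i$ is a two-state (bad $=0$, good $=1$) Markov chain with transition probabilities $p^{(i)}_{jk}$ without absorbing states ($p^{(i)}_{01}\neq 0$, $p^{(i)}_{10}=1-p^{(i)}_{11}\neq 0$), and with rate $B_i>0$. The state of an arm as a bandit is the belief $\omega\in[0,1]$, the conditional probability that the chain is in state $1$. Activating arm $i$ at belief $\omega$ gives expected reward $\omega B_i$ and moves the belief to $p^{(i)}_{11}$ with probability $\omega$ and to $p^{(i)}_{01}$ with probability $1-\omega$; a passive arm moves to ${\cal T}(\omega)=\omega p^{(i)}_{11}+(1-\omega)p^{(i)}_{01}$. Let ${\cal T}^k$ be the $k$-fold iterate, $\omega^{(i)}_o=p^{(i)}_{01}/(p^{(i)}_{01}+p^{(i)}_{10})$, and $L(\omega,\omega')=\min\{k\ge 0:{\cal T}^k(\omega)>\omega'\}$. In the single-armed process with subsidy $m$, the passive action is rewarded by $m$. Under the average reward criterion, a relative value function is a continuous $h:[0,1]\to\mathbb R$ such that the maximum expected average reward is a constant $g$ on $[0,1]$ and $$g+h(\omega)=\max\{\,m+h({\cal T}(\omega)),\ \omega B_i+\omega h(p^{(i)}_{11})+(1-\omega)h(p^{(i)}_{01})\,\},\qquad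 \omega\in[0,1].$$ The passive set ${\cal P}(m)$ consists of the $\omega\in[0,1]$ at which the first (passive) term attains the maximum for some relative value function $h$. The arm is indexable if ${\cal P}(m)$ increases monotonically from $\emptyset$ to $[0,1]$ as $m$ increases from $-\infty$ to $+\infty$, and its Whittle index is $W(\omega)=\inf\{m:\omega\in{\cal P}(m)\}$. The restless multi-armed bandit process is indexable if every arm is. The discounted index $W_\beta(\omega)$, $0\le\beta<1$, is defined in the same way from the discounted value function. Theorem. Under the average reward criterion, for every arm and every subsidy $m$ a relative value function exists, and the restless multi-armed bandit process is indexable. For every arm, every $\omega\in[0,1]$, every $m$ and every relative value function $h$ under $m$, the active action is strictly better at $\omega$ if $m<W(\omega)$, and the passive action is optimal at $\omega$ if $m>W(\omega)$. For each arm $W(\omega)=\lim_{\beta\uparrow 1}W_\beta(\omega)$ for all $\omega\in[0,1]$, and $W$ is given as follows (with the arm index dropped from $p_{jk}$, $\omega_o$, $B$). Case 1 (positively correlated arm, $p_{11}\ge p_{01}$): $$W(\omega)=\begin{cases}\omega B,&\omega\le p_{01}\text{ or }\omega\ge p_{11},\\[2pt] \dfrac{(\omega-{\cal T}(\omega))(L(p_{01},\omega)+1)+{\cal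 T}^{L(p_{01},\omega)}(p_{01})}{1-p_{11}+(\omega-{\cal T}(\omega))L(p_{01},\omega)+{\cal T}^{L(p_{01},\omega)}(p_{01})}\,B,&p_{01}<\omega<\omega_o,\\[6pt] \dfrac{\omega}{1-p_{11}+\omega}\,B,&\omega_o\le\omega<p_{11}.\end{cases}$$ Case 2 (negatively correlated arm, $p_{11}<p_{01}$): $$W(\omega)=\begin{cases}\omega B,&\omega\le p_{11}\text{ or }\omega\ge p_{01},\\[2pt] \dfrac{\omega+p_{01}-{\cal T}(\omega)}{1+p_{01}-{\cal T}(p_{11})+{\cal T}(\omega)-\omega}\,B,&p_{11}<\omega<\omega_o,\\[6pt] \dfrac{p_{01}}{1+p_{01}-{\cal T}(p_{11})}\,B,&\omega_o\le\omega<{\cal T}(p_{11}),\\[6pt] \dfrac{p_{01}}{1+p_{01}-\omega}\,B,&{\cal T}(p_{11})\le\omega<p_{01}.\end{cases}$$ In particular, for a negatively correlated arm $W$ is constant on $[\omega_o,{\cal T}(p_{11}))$. -/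

import Mathlib

open Set Filter Topology

/-- One arm: a two-state (`0` = bad, `1` = good) Markov chain with transition probabilities
`p01` (from `0` to `1`) and `p11` (from `1` to `1`), together with its transmission rate `B`. -/
structure Arm where
  p01 : ℝ
  p11 : ℝ
  B : ℝ
  p01_mem : p01 ∈ Icc (0 : ℝ) 1
  p11_mem : p11 ∈ Icc (0 : ℝ) 1
  B_pos : 0 < B

/-- A policy for a single arm: in slot `t`, at belief `ω`, the arm is made active
iff `π t ω = true`. -/
abbrev Policy : Type := ℕ → ℝ → Bool

/-- The policy that remains after the first slot has passed. -/
def Policy.shift (π : Policy) : Policy := fun t ω => π (t + 1) ω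

/-- A set-valued function of the subsidy `m` increases monotonically from the empty set to the
whole belief space `[0,1]` as `m` runs from `-∞` to `+∞`. -/
def IncreasesFromEmptyToAll (P : ℝ → Set ℝ) : Prop :=
  Monotone P ∧ (∀ᶠ m in atBot, P m = ∅) ∧ (∀ᶠ m in atTop, P m = Icc (0 : ℝ) 1)

namespace Arm

variable (a : Arm)

/-- The transition probability from `1` to `0`. -/
def p10 : ℝ := 1 - a.p11

/-- The arm has no absorbing state: neither `0` (`p01 = 0`) nor `1` (`p10 = 0`) is absorbing. -/
def NoAbsorbingState : Prop := a.p01 ≠ 0 ∧ a.p10 ≠ 0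

/-- One-step belief update of a passive (unobserved) arm. -/
def T (ω : ℝ) : ℝ := ω * a.p11 + (1 - ω) * a.p01

/-- The stationary probability of the good state. -/
noncomputable def stationary : ℝ := a.p01 / (a.p01 + a.p10)

/-- The crossing time `min {k : T^k(ω) > ω'}`
(only used below where this set of natural numbers is nonempty). -/
noncomputable def crossingTime (ω ω' : ℝ) : ℕ := sInf {k : ℕ | ω' < a.T^[k] ω}

/-! ### The single-armed bandit process with subsidy `m` -/

/-- Expected reward obtained in slot `t` (slots are numbered from `0`) under the policy `π`, when
the initial belief is `ω`. In each slot, the passive action yields the subsidy `m` and moves the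
belief to `T ω`; the active action yields the expected reward `ω * B` and moves the belief to `p11`
with probability `ω` and to `p01` with probability `1 - ω`. -/
noncomputable def expectedReward (m : ℝ) : Policy → ℕ → ℝ → ℝ
  | π, 0, ω => if π 0 ω then ω * a.B else m
  | π, t + 1, ω =>
      if π 0 ω then
        ω * expectedReward m π.shift t a.p11 + (1 - ω) * expectedReward m π.shift t a.p01
      else expectedReward m π.shift t (a.T ω)

/-! ### Discounted reward criterion -/

/-- The value function `V_{β,m}(ω)`: the maximum expected total discounted reward. -/
noncomputable def discountedValue (β m ω : ℝ) : ℝ :=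
  ⨆ π : Policy, ∑' t : ℕ, β ^ t * a.expectedReward m π t ω

/-- `V_{β,m}(ω; u = 0)`. -/
noncomputable def discountedPassive (β m ω : ℝ) : ℝ :=
  m + β * a.discountedValue β m (a.T ω)

/-- `V_{β,m}(ω; u = 1)`. -/
noncomputable def discountedActive (β m ω : ℝ) : ℝ :=
  ω * a.B +
    β * (ω * a.discountedValue β m a.p11 + (1 - ω) * a.discountedValue β m a.p01)

/-- The passive set under subsidy `m`, discounted criterion. -/
def discountedPassiveSet (β m : ℝ) : Set ℝ :=
  {ω ∈ Icc (0 : ℝ) 1 | a.discountedActive β m ω ≤ a.discountedPassive β m ω}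

/-- Whittle's index `W_β(ω)` under the discounted criterion: the infimum subsidy that makes it
optimal to be passive at `ω`. -/
noncomputable def discountedWhittleIndex (β ω : ℝ) : ℝ :=
  sInf {m : ℝ | ω ∈ a.discountedPassiveSet β m}

/-! ### Average reward criterion -/

/-- The expected average reward over the infinite horizon of a policy from initial belief `ω`. -/
noncomputable def averageReward (m : ℝ) (π : Policy) (ω : ℝ) : ℝ :=
  liminf (fun n : ℕ => (∑ t ∈ Finset.range n, a.expectedReward m π t ω) / n) atTop

/-- The maximum expected average reward over the infinite horizon from initial belief `ω`. -/
noncomputable def optimalAverageReward (m ω : ℝ) : ℝ :=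
  ⨆ π : Policy, a.averageReward m π ω

/-- Right-hand side of the average-reward dynamic programming equation for the passive action,
`h` being the relative value function. -/
def averagePassive (m : ℝ) (h : ℝ → ℝ) (ω : ℝ) : ℝ := m + h (a.T ω)

/-- Right-hand side of the average-reward dynamic programming equation for the active action,
`h` being the relative value function. -/
def averageActive (h : ℝ → ℝ) (ω : ℝ) : ℝ :=
  ω * a.B + (ω * h a.p11 + (1 - ω) * h a.p01)

/-- `h` is a relative value function under subsidy `m` for the average reward criterion: the
maximum expected average reward is a constant `g` on `[0,1]`, and the continuous function `h`
solves the dynamic programming equation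
`g + h ω = max {m + h (T ω), ω B + ω h(p11) + (1 - ω) h(p01)}` on `[0,1]`. -/
def IsRelativeValue (m : ℝ) (h : ℝ → ℝ) : Prop :=
  ContinuousOn h (Icc (0 : ℝ) 1) ∧
    ∃ g : ℝ, (∀ ω ∈ Icc (0 : ℝ) 1, a.optimalAverageReward m ω = g) ∧
      ∀ ω ∈ Icc (0 : ℝ) 1, g + h ω = max (a.averagePassive m h ω) (a.averageActive h ω)

/-- The passive set under subsidy `m`, average reward criterion: the beliefs at which the passive
action is optimal, i.e. attains the maximum in the dynamic programming equation. (A relative value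
function need not be unique at an exceptional subsidy; it suffices that the passive action is
optimal with respect to one of them.) -/
def averagePassiveSet (m : ℝ) : Set ℝ :=
  {ω ∈ Icc (0 : ℝ) 1 |
    ∃ h : ℝ → ℝ, a.IsRelativeValue m h ∧ a.averageActive h ω ≤ a.averagePassive m h ω}

/-- Indexability of the arm under the average reward criterion. -/
def AverageIndexable : Prop := IncreasesFromEmptyToAll a.averagePassiveSet

/-- Whittle's index `W(ω)` under the average reward criterion: the infimum subsidy that makes it
optimal to be passive at `ω`. -/
noncomputable def averageWhittleIndex (ω : ℝ) : ℝ :=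
  sInf {m : ℝ | ω ∈ a.averagePassiveSet m}

end Arm

/-- The restless multi-armed bandit process with `N` arms: initial belief vector and arms. -/
structure RMBP (N : ℕ) where
  init : Fin N → Icc (0 : ℝ) 1
  arm : Fin N → Arm

/-- The RMBP is indexable under the average reward criterion if every arm is. -/
def RMBP.AverageIndexable {N : ℕ} (X : RMBP N) : Prop := ∀ i, (X.arm i).AverageIndexable

namespace Arm

variable {a : Arm}

/-! Existence is by vanishing discount. The discounted value functions are Lipschitz uniformly in
`β`, so after subtracting their value at `p01` they converge along an ultrafilter of discount
factors tending to `1`, and the limit solves the average reward equation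
(`exists_solvesDP_of_tendsto`). Verification (`SolvesDP.optimalAverageReward_eq`) identifies the
constant `g` with the optimal average reward.

The index comes from a normal form (`SolvesDP.exists_stopping`). The active branch is affine in the
belief, with slope `s = B + h(p11) - h(p01) > 0`. For `f = (h - h(p01) + g) / s` and `v = (g - m) /
s ≥ 0` the equation becomes `f = max (f ∘ T - v) id`: stop the deterministic orbit of `T`, receive
the current belief, pay `v` per step. The subsidy is recovered as `m = B (f(p01) - v) / (1 + f(p01)
- f(p11))`. When `v = 0` a second parameter remains, the payoff `θ = f(ω_o)` of never stopping.

The critical parameters of a belief `ω` are `v = max (T ω - ω) 0` and, when this is `0`, `θ = ω`.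
Lowering `v`, or raising `θ` at `v = 0`, raises both stopping values and also the ratio
(`stopping_ratio_mono`). Hence comparing `m` with `B` times the ratio at the critical parameters
decides the action at `ω` (`SolvesDP.decision`), and that number is the index. The closed forms are
the optimal stopping values from `p01` and `p11`. The flip `T ω = 1 - ω` with `v = 0` is treated
apart, as its orbits need not converge.

If the discounted indices failed to converge to `W`, a limit along an ultrafilter would be a
relative value function whose decision contradicts `SolvesDP.decision_index`. -/

lemma NoAbsorbingState.p01_pos (h : a.NoAbsorbingState) : 0 < a.p01 :=
  lt_of_le_of_ne a.p01_mem.1 (Ne.symm h.1)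

lemma NoAbsorbingState.p11_lt_one (h : a.NoAbsorbingState) : a.p11 < 1 :=
  lt_of_le_of_ne a.p11_mem.2 fun h1 => h.2 (by simp [p10, h1])

lemma T_mem {ω : ℝ} (hω : ω ∈ Icc (0 : ℝ) 1) : a.T ω ∈ Icc (0 : ℝ) 1 := by
  obtain ⟨h0, h1⟩ := hω
  have hp := a.p01_mem
  have hq := a.p11_mem
  unfold T
  constructor
  · have := mul_nonneg h0 hq.1
    have := mul_nonneg (sub_nonneg.2 h1) hp.1
    linarith
  · have := mul_le_mul_of_nonneg_left hq.2 h0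
    have := mul_le_mul_of_nonneg_left hp.2 (sub_nonneg.2 h1)
    linarith

lemma iterate_T_mem {ω : ℝ} (hω : ω ∈ Icc (0 : ℝ) 1) (k : ℕ) : a.T^[k] ω ∈ Icc (0 : ℝ) 1 := by
  induction k with
  | zero => exact hω
  | succ k ih => rw [Function.iterate_succ_apply']; exact T_mem ih

lemma T_sub_T (x y : ℝ) : a.T x - a.T y = (a.p11 - a.p01) * (x - y) := by
  unfold T; ring

lemma abs_corr_le : |a.p11 - a.p01| ≤ 1 := by
  have hp := a.p01_mem
  have hq := a.p11_mem
  rw [abs_le]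
  constructor <;> linarith [hp.1, hp.2, hq.1, hq.2]

/-- `V` solves on `[0,1]` the dynamic programming equation with discount factor `β`, subsidy `m`
and gain `c`. The average reward criterion is `β = 1`, the discounted one is `c = 0`. -/
def SolvesDP (a : Arm) (β m c : ℝ) (V : ℝ → ℝ) : Prop :=
  ∀ ω ∈ Icc (0 : ℝ) 1, c + V ω =
    max (m + β * V (a.T ω)) (ω * a.B + β * (ω * V a.p11 + (1 - ω) * V a.p01))

/-! ### Verification -/

lemma sum_expectedReward_succ (β m : ℝ) (π : Policy) (n : ℕ) (ω : ℝ) :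
    ∑ t ∈ Finset.range (n + 1), β ^ t * a.expectedReward m π t ω =
      if π 0 ω then
        ω * a.B + β * (ω * ∑ t ∈ Finset.range n, β ^ t * a.expectedReward m π.shift t a.p11 +
          (1 - ω) * ∑ t ∈ Finset.range n, β ^ t * a.expectedReward m π.shift t a.p01)
      else m + β * ∑ t ∈ Finset.range n, β ^ t * a.expectedReward m π.shift t (a.T ω) := by
  rw [Finset.sum_range_succ']
  by_cases h : π 0 ω
  · simp only [expectedReward, h, if_true, pow_zero, one_mul]
    rw [add_comm]
    congr 1
    simp only [Finset.mul_sum]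
    rw [← Finset.sum_add_distrib, Finset.mul_sum]
    refine Finset.sum_congr rfl fun t _ => ?_
    ring
  · simp only [expectedReward, h, pow_zero, one_mul]
    simp only [Bool.false_eq_true, if_false]
    rw [add_comm]
    congr 1
    rw [Finset.mul_sum]
    refine Finset.sum_congr rfl fun t _ => ?_
    ring

lemma geom_succ (β : ℝ) (n : ℕ) :
    ∑ t ∈ Finset.range (n + 1), β ^ t = 1 + β * ∑ t ∈ Finset.range n, β ^ t := by
  rw [Finset.sum_range_succ', Finset.mul_sum, add_comm]
  simp [pow_succ, mul_comm]

/-- Induction on the horizon: no action beats the maximum in the equation, and `β ^ n * M` absorbs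
the value of the belief reached at the end. The one estimate serves both criteria. -/
lemma SolvesDP.sum_le {β m c M : ℝ} {V : ℝ → ℝ} (hV : a.SolvesDP β m c V) (hβ : 0 ≤ β)
    (hM : ∀ ω ∈ Icc (0 : ℝ) 1, |V ω| ≤ M) (n : ℕ) :
    ∀ (π : Policy), ∀ ω ∈ Icc (0 : ℝ) 1,
      ∑ t ∈ Finset.range n, β ^ t * a.expectedReward m π t ω ≤
        V ω + c * ∑ t ∈ Finset.range n, β ^ t + β ^ n * M := by
  induction n with
  | zero =>
    intro π ω hω
    have := (abs_le.1 (hM ω hω)).1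
    simp only [Finset.range_zero, Finset.sum_empty, pow_zero]
    linarith
  | succ n ih =>
    intro π ω hω
    rw [sum_expectedReward_succ, geom_succ, pow_succ]
    have hd := hV ω hω
    split_ifs with h
    · have h1 := le_max_right (m + β * V (a.T ω))
        (ω * a.B + β * (ω * V a.p11 + (1 - ω) * V a.p01))
      rw [← hd] at h1
      have h2 := mul_le_mul_of_nonneg_left (ih π.shift _ a.p11_mem) (mul_nonneg hβ hω.1)
      have h3 := mul_le_mul_of_nonneg_left (ih π.shift _ a.p01_mem)
        (mul_nonneg hβ (sub_nonneg.2 hω.2))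
      linarith
    · have h1 := le_max_left (m + β * V (a.T ω))
        (ω * a.B + β * (ω * V a.p11 + (1 - ω) * V a.p01))
      rw [← hd] at h1
      have h2 := mul_le_mul_of_nonneg_left (ih π.shift _ (T_mem (a := a) hω)) hβ
      linarith

open Classical in
/-- The stationary policy that is greedy with respect to `V`. -/
noncomputable def greedy (a : Arm) (β m : ℝ) (V : ℝ → ℝ) : Policy := fun _ ω =>
  decide (m + β * V (a.T ω) ≤ ω * a.B + β * (ω * V a.p11 + (1 - ω) * V a.p01))

/-- The greedy policy attains the maximum in every slot, so the induction of `SolvesDP.sum_le` runs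
with the inequality reversed. -/
lemma SolvesDP.le_sum_greedy {β m c M : ℝ} {V : ℝ → ℝ} (hV : a.SolvesDP β m c V) (hβ : 0 ≤ β)
    (hM : ∀ ω ∈ Icc (0 : ℝ) 1, |V ω| ≤ M) (n : ℕ) :
    ∀ ω ∈ Icc (0 : ℝ) 1,
      V ω + c * ∑ t ∈ Finset.range n, β ^ t - β ^ n * M ≤
      ∑ t ∈ Finset.range n, β ^ t * a.expectedReward m (a.greedy β m V) t ω := by
  induction n with
  | zero =>
    intro ω hω
    have := (abs_le.1 (hM ω hω)).2
    simp only [Finset.range_zero, Finset.sum_empty, pow_zero]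
    linarith
  | succ n ih =>
    intro ω hω
    rw [sum_expectedReward_succ, geom_succ, pow_succ]
    have hd := hV ω hω
    have hs : (a.greedy β m V).shift = a.greedy β m V := rfl
    rw [hs]
    split_ifs with h
    · simp only [greedy, decide_eq_true_eq] at h
      rw [max_eq_right h] at hd
      have h2 := mul_le_mul_of_nonneg_left (ih _ a.p11_mem) (mul_nonneg hβ hω.1)
      have h3 := mul_le_mul_of_nonneg_left (ih _ a.p01_mem)
        (mul_nonneg hβ (sub_nonneg.2 hω.2))
      linarith
    · simp only [greedy, decide_eq_true_eq, not_le] at h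
      rw [max_eq_left h.le] at hd
      have h2 := mul_le_mul_of_nonneg_left (ih _ (T_mem (a := a) hω)) hβ
      linarith

lemma abs_expectedReward_le (m : ℝ) (t : ℕ) :
    ∀ (π : Policy), ∀ ω ∈ Icc (0 : ℝ) 1, |a.expectedReward m π t ω| ≤ max |m| a.B := by
  induction t with
  | zero =>
    intro π ω hω
    unfold expectedReward
    split_ifs
    · rw [abs_of_nonneg (mul_nonneg hω.1 a.B_pos.le)]
      exact (mul_le_of_le_one_left a.B_pos.le hω.2).trans (le_max_right _ _)
    · exact le_max_left _ _
  | succ t ih =>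
    intro π ω hω
    unfold expectedReward
    split_ifs
    · refine (abs_add_le _ _).trans ?_
      rw [abs_mul, abs_mul, abs_of_nonneg hω.1, abs_of_nonneg (sub_nonneg.2 hω.2)]
      have h2 := mul_le_mul_of_nonneg_left (ih π.shift _ a.p11_mem) hω.1
      have h3 := mul_le_mul_of_nonneg_left (ih π.shift _ a.p01_mem) (sub_nonneg.2 hω.2)
      linarith
    · exact ih _ _ (T_mem hω)

lemma SolvesDP.discountedValue_eq {β m M : ℝ} {V : ℝ → ℝ} (hV : a.SolvesDP β m 0 V) (hβ : 0 ≤ β)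
    (hβ1 : β < 1) (hM : ∀ ω ∈ Icc (0 : ℝ) 1, |V ω| ≤ M) {ω : ℝ} (hω : ω ∈ Icc (0 : ℝ) 1) :
    a.discountedValue β m ω = V ω := by
  have hs : ∀ π : Policy, Summable fun t : ℕ => β ^ t * a.expectedReward m π t ω := by
    intro π
    refine Summable.of_norm_bounded
      ((summable_geometric_of_lt_one hβ hβ1).mul_right (max |m| a.B)) fun t => ?_
    rw [Real.norm_eq_abs, abs_mul, abs_of_nonneg (pow_nonneg hβ t)]
    exact mul_le_mul_of_nonneg_left (abs_expectedReward_le m t π ω hω) (pow_nonneg hβ t)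
  have hz : Tendsto (fun n : ℕ => β ^ n * M) atTop (𝓝 0) := by
    simpa using (tendsto_pow_atTop_nhds_zero_of_lt_one hβ hβ1).mul_const M
  have hle : ∀ π : Policy, ∑' t : ℕ, β ^ t * a.expectedReward m π t ω ≤ V ω := by
    intro π
    have h1 : Tendsto (fun n : ℕ => V ω + β ^ n * M) atTop (𝓝 (V ω)) := by
      simpa using hz.const_add (V ω)
    refine le_of_tendsto_of_tendsto' (hs π).hasSum.tendsto_sum_nat h1 fun n => ?_
    simpa using hV.sum_le hβ hM n π ω hω
  have hge : V ω ≤ ∑' t : ℕ, β ^ t * a.expectedReward m (a.greedy β m V) t ω := by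
    have h1 : Tendsto (fun n : ℕ => V ω - β ^ n * M) atTop (𝓝 (V ω)) := by
      simpa using hz.const_sub (V ω)
    refine le_of_tendsto_of_tendsto' h1 (hs _).hasSum.tendsto_sum_nat fun n => ?_
    simpa using hV.le_sum_greedy hβ hM n ω hω
  unfold discountedValue
  apply le_antisymm
  · exact ciSup_le hle
  · exact hge.trans (le_ciSup (f := fun π : Policy => ∑' t : ℕ, β ^ t * a.expectedReward m π t ω)
      ⟨V ω, by rintro _ ⟨π, rfl⟩; exact hle π⟩ _)

lemma SolvesDP.optimalAverageReward_eq {m g M : ℝ} {h : ℝ → ℝ} (hV : a.SolvesDP 1 m g h)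
    (hM : ∀ ω ∈ Icc (0 : ℝ) 1, |h ω| ≤ M) {ω : ℝ} (hω : ω ∈ Icc (0 : ℝ) 1) :
    a.optimalAverageReward m ω = g := by
  have hlim : ∀ C : ℝ, Tendsto (fun n : ℕ => g + C / n) atTop (𝓝 g) := fun C => by
    simpa using (tendsto_const_div_atTop_nhds_zero_nat C).const_add g
  have hub : ∀ (π : Policy) (n : ℕ), 0 < n →
      (∑ t ∈ Finset.range n, a.expectedReward m π t ω) / n ≤ g + (h ω + M) / n := by
    intro π n hn
    have hn' : (0 : ℝ) < n := by exact_mod_cast hn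
    have := hV.sum_le zero_le_one hM n π ω hω
    simp only [one_pow, one_mul, Finset.sum_const, Finset.card_range, nsmul_eq_mul, mul_one] at this
    rw [div_le_iff₀ hn', add_mul, div_mul_cancel₀ _ hn'.ne']
    linarith
  have hlb : ∀ n : ℕ, 0 < n →
      g + (h ω - M) / n ≤
        (∑ t ∈ Finset.range n, a.expectedReward m (a.greedy 1 m h) t ω) / n := by
    intro n hn
    have hn' : (0 : ℝ) < n := by exact_mod_cast hn
    have := hV.le_sum_greedy zero_le_one hM n ω hω
    simp only [one_pow, one_mul, Finset.sum_const, Finset.card_range, nsmul_eq_mul, mul_one] at this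
    rw [le_div_iff₀ hn', add_mul, div_mul_cancel₀ _ hn'.ne']
    linarith
  have hle : ∀ π : Policy, a.averageReward m π ω ≤ g := by
    intro π
    unfold averageReward
    rw [← (hlim (h ω + M)).liminf_eq]
    refine liminf_le_liminf ?_ ?_ ?_
    · filter_upwards [eventually_gt_atTop 0] with n hn using hub π n hn
    · refine isBoundedUnder_of ⟨-max |m| a.B, fun n => ?_⟩
      rcases Nat.eq_zero_or_pos n with rfl | hn
      · simp only [Finset.range_zero, Finset.sum_empty, zero_div]
        exact neg_nonpos.2 ((abs_nonneg m).trans (le_max_left _ _))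
      · have hn' : (0 : ℝ) < n := by exact_mod_cast hn
        rw [ge_iff_le, le_div_iff₀ hn']
        have : ∑ t ∈ Finset.range n, -max |m| a.B ≤
            ∑ t ∈ Finset.range n, a.expectedReward m π t ω :=
          Finset.sum_le_sum fun t _ => (abs_le.1 (abs_expectedReward_le m t π ω hω)).1
        simp only [Finset.sum_const, Finset.card_range, nsmul_eq_mul] at this
        linarith
    · exact (hlim (h ω + M)).isBoundedUnder_le.isCoboundedUnder_ge
  have hge : a.averageReward m (a.greedy 1 m h) ω = g := by
    refine Tendsto.liminf_eq (tendsto_of_tendsto_of_tendsto_of_le_of_le' (hlim (h ω - M))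
      (hlim (h ω + M)) ?_ ?_)
    · filter_upwards [eventually_gt_atTop 0] with n hn using hlb n hn
    · filter_upwards [eventually_gt_atTop 0] with n hn using hub _ n hn
  unfold optimalAverageReward
  apply le_antisymm
  · exact ciSup_le hle
  · rw [← hge]
    exact le_ciSup (f := fun π : Policy => a.averageReward m π ω)
      ⟨g, by rintro _ ⟨π, rfl⟩; exact hle π⟩ _

lemma IsRelativeValue.solvesDP {m : ℝ} {h : ℝ → ℝ} (hh : a.IsRelativeValue m h) :
    ∃ g, a.SolvesDP 1 m g h := by
  obtain ⟨-, g, -, hg⟩ := hh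
  exact ⟨g, fun ω hω => by simpa [averagePassive, averageActive] using hg ω hω⟩

lemma SolvesDP.isRelativeValue {m g : ℝ} {h : ℝ → ℝ} (hg : a.SolvesDP 1 m g h)
    (hc : ContinuousOn h (Icc 0 1)) : a.IsRelativeValue m h := by
  obtain ⟨M, hM⟩ := isCompact_Icc.exists_bound_of_continuousOn hc
  refine ⟨hc, g, fun ω hω => hg.optimalAverageReward_eq (M := M) hM hω, fun ω hω => ?_⟩
  simpa [averagePassive, averageActive] using hg ω hω

/-! ### The discounted value function -/

/-- The projection of the real line onto the belief space. -/
def clamp (x : ℝ) : ℝ := max 0 (min 1 x)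

lemma clamp_mem (x : ℝ) : clamp x ∈ Icc (0 : ℝ) 1 :=
  ⟨le_max_left _ _, max_le zero_le_one (min_le_left _ _)⟩

lemma clamp_of_mem {x : ℝ} (hx : x ∈ Icc (0 : ℝ) 1) : clamp x = x := by
  rw [clamp, min_eq_right hx.2, max_eq_right hx.1]

lemma continuous_clamp : Continuous clamp := by
  unfold clamp; fun_prop

lemma abs_convexComb_le {ω x y M : ℝ} (hω : ω ∈ Icc (0 : ℝ) 1) (hx : |x| ≤ M) (hy : |y| ≤ M) :
    |ω * x + (1 - ω) * y| ≤ M := by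
  refine (abs_add_le _ _).trans ?_
  rw [abs_mul, abs_mul, abs_of_nonneg hω.1, abs_of_nonneg (sub_nonneg.2 hω.2)]
  have h2 := mul_le_mul_of_nonneg_left hx hω.1
  have h3 := mul_le_mul_of_nonneg_left hy (sub_nonneg.2 hω.2)
  linarith

lemma abs_bellman_le {β m M : ℝ} {V : ℝ → ℝ} (hβ : 0 ≤ β) (hM : ∀ x, |V x| ≤ M) {ω : ℝ}
    (hω : ω ∈ Icc (0 : ℝ) 1) :
    |max (m + β * V (a.T ω)) (ω * a.B + β * (ω * V a.p11 + (1 - ω) * V a.p01))| ≤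
      max |m| a.B + β * M := by
  refine abs_max_le_max_abs_abs.trans (max_le ?_ ?_)
  · refine (abs_add_le _ _).trans (add_le_add (le_max_left _ _) ?_)
    rw [abs_mul, abs_of_nonneg hβ]
    exact mul_le_mul_of_nonneg_left (hM _) hβ
  · refine (abs_add_le _ _).trans (add_le_add ?_ ?_)
    · rw [abs_of_nonneg (mul_nonneg hω.1 a.B_pos.le)]
      exact (mul_le_of_le_one_left a.B_pos.le hω.2).trans (le_max_right _ _)
    · rw [abs_mul, abs_of_nonneg hβ]
      exact mul_le_mul_of_nonneg_left (abs_convexComb_le hω (hM _) (hM _)) hβ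

open BoundedContinuousFunction in
-- Banach's fixed point theorem for the Bellman operator. Projecting the belief by `clamp` lets the
-- operator act on bounded continuous functions on all of `ℝ`.
lemma exists_solvesDP_discounted (a : Arm) {β : ℝ} (m : ℝ) (hβ : 0 ≤ β) (hβ1 : β < 1) :
    ∃ V : ℝ → ℝ, a.SolvesDP β m 0 V ∧
      ∀ ω ∈ Icc (0 : ℝ) 1, (1 - β) * |V ω| ≤ max |m| a.B := by
  have hT : Continuous a.T := by unfold T; fun_prop
  have hcl := continuous_clamp
  let F : (ℝ →ᵇ ℝ) → (ℝ →ᵇ ℝ) := fun V =>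
    BoundedContinuousFunction.ofNormedAddCommGroup
      (fun x => max (m + β * V (a.T (clamp x)))
        (clamp x * a.B + β * (clamp x * V a.p11 + (1 - clamp x) * V a.p01)))
      (by
        have hV := V.continuous
        fun_prop)
      (max |m| a.B + β * ‖V‖)
      (fun x => abs_bellman_le hβ (fun y => V.norm_coe_le_norm y) (clamp_mem x))
  have hF : ContractingWith ⟨β, hβ⟩ F := by
    refine ⟨by exact_mod_cast hβ1, LipschitzWith.of_dist_le_mul fun V W => ?_⟩
    refine (BoundedContinuousFunction.dist_le (mul_nonneg hβ dist_nonneg)).2 fun x => ?_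
    have hVW : ∀ y, |V y - W y| ≤ dist V W := fun y => by
      rw [← Real.dist_eq]; exact BoundedContinuousFunction.dist_coe_le_dist y
    rw [Real.dist_eq]
    refine (abs_max_sub_max_le_max _ _ _ _).trans (max_le ?_ ?_)
    · rw [add_sub_add_left_eq_sub, ← mul_sub, abs_mul, abs_of_nonneg hβ]
      exact mul_le_mul_of_nonneg_left (hVW _) hβ
    · rw [add_sub_add_left_eq_sub, ← mul_sub, abs_mul, abs_of_nonneg hβ]
      refine mul_le_mul_of_nonneg_left ?_ hβ
      have := abs_convexComb_le (clamp_mem x) (hVW a.p11) (hVW a.p01)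
      refine le_trans (le_of_eq (congrArg abs ?_)) this
      ring
  obtain ⟨V, hV⟩ : ∃ V, F V = V := ⟨_, hF.fixedPoint_isFixedPt⟩
  refine ⟨V, fun ω hω => ?_, fun ω _ => ?_⟩
  · have h1 : F V ω = V ω := by rw [hV]
    have h2 : F V ω = max (m + β * V (a.T (clamp ω)))
        (clamp ω * a.B + β * (clamp ω * V a.p11 + (1 - clamp ω) * V a.p01)) := rfl
    rw [zero_add, ← h1, h2, clamp_of_mem hω]
  · have h1 : ‖F V‖ ≤ max |m| a.B + β * ‖V‖ :=
      BoundedContinuousFunction.norm_ofNormedAddCommGroup_le _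
        (add_nonneg ((abs_nonneg m).trans (le_max_left _ _)) (mul_nonneg hβ (norm_nonneg _))) _
    rw [hV] at h1
    have h2 : |V ω| ≤ ‖V‖ := V.norm_coe_le_norm ω
    have := mul_le_mul_of_nonneg_left h2 (sub_nonneg.2 hβ1.le)
    linarith

lemma solvesDP_discountedValue (a : Arm) {β : ℝ} (m : ℝ) (hβ : 0 ≤ β) (hβ1 : β < 1) :
    a.SolvesDP β m 0 (a.discountedValue β m) ∧
      ∀ ω ∈ Icc (0 : ℝ) 1, (1 - β) * |a.discountedValue β m ω| ≤ max |m| a.B := by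
  obtain ⟨V, hV, hb⟩ := a.exists_solvesDP_discounted m hβ hβ1
  have he : ∀ ω ∈ Icc (0 : ℝ) 1, a.discountedValue β m ω = V ω := fun ω hω =>
    hV.discountedValue_eq (M := max |m| a.B / (1 - β)) hβ hβ1 (fun x hx => by
      rw [le_div_iff₀ (sub_pos.2 hβ1), mul_comm]; exact hb x hx) hω
  refine ⟨fun ω hω => ?_, fun ω hω => by rw [he ω hω]; exact hb ω hω⟩
  rw [he ω hω, he _ (T_mem hω), he _ a.p11_mem, he _ a.p01_mem]
  exact hV ω hω

/-- A sequence of errors that vanishes geometrically. -/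
lemma le_of_forall_le_add_pow_mul {x y β M : ℝ} (hβ : 0 ≤ β) (hβ1 : β < 1)
    (h : ∀ n : ℕ, x ≤ y + β ^ n * M) : x ≤ y := by
  have : Tendsto (fun n : ℕ => y + β ^ n * M) atTop (𝓝 y) := by
    simpa using ((tendsto_pow_atTop_nhds_zero_of_lt_one hβ hβ1).mul_const M).const_add y
  exact ge_of_tendsto' this h

/-- The active branch is affine with slope `s`; the passive branch precomposes with the nonexpansive
`T` and discounts. Iterating the equation makes the crude bound `2 * M` disappear. -/
lemma SolvesDP.abs_sub_le {β m M : ℝ} {V : ℝ → ℝ} (hV : a.SolvesDP β m 0 V) (hβ : 0 ≤ β)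
    (hβ1 : β < 1) (hM : ∀ ω ∈ Icc (0 : ℝ) 1, |V ω| ≤ M) {x y : ℝ}
    (hx : x ∈ Icc (0 : ℝ) 1) (hy : y ∈ Icc (0 : ℝ) 1) :
    |V x - V y| ≤ |a.B + β * (V a.p11 - V a.p01)| * |x - y| := by
  set s := a.B + β * (V a.p11 - V a.p01) with hs
  refine le_of_forall_le_add_pow_mul (M := 2 * M) hβ hβ1 fun n => ?_
  have hM0 : 0 ≤ M := (abs_nonneg _).trans (hM x hx)
  induction n generalizing x y with
  | zero =>
    have h1 := abs_sub (V x) (V y)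
    have h2 := hM x hx
    have h3 := hM y hy
    have h4 := mul_nonneg (abs_nonneg s) (abs_nonneg (x - y))
    rw [pow_zero]
    linarith
  | succ n ih =>
    have hx1 := hV x hx
    have hy1 := hV y hy
    rw [zero_add] at hx1 hy1
    rw [hx1, hy1]
    refine (abs_max_sub_max_le_max _ _ _ _).trans (max_le ?_ ?_)
    · rw [add_sub_add_left_eq_sub, ← mul_sub, abs_mul, abs_of_nonneg hβ]
      have h1 := mul_le_mul_of_nonneg_left (ih (T_mem (a := a) hx) (T_mem (a := a) hy)) hβ
      have h2 : |a.T x - a.T y| ≤ |x - y| := by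
        rw [T_sub_T, abs_mul]
        exact mul_le_of_le_one_left (abs_nonneg _) abs_corr_le
      have h3 : β * (|s| * |a.T x - a.T y|) ≤ |s| * |x - y| :=
        (mul_le_of_le_one_left (mul_nonneg (abs_nonneg _) (abs_nonneg _)) hβ1.le).trans
          (mul_le_mul_of_nonneg_left h2 (abs_nonneg _))
      rw [pow_succ]
      linarith
    · have : x * a.B + β * (x * V a.p11 + (1 - x) * V a.p01)
          - (y * a.B + β * (y * V a.p11 + (1 - y) * V a.p01)) = s * (x - y) := by
        rw [hs]; ring
      rw [this, abs_mul]
      have := mul_nonneg (pow_nonneg hβ (n + 1)) hM0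
      linarith

/-- Convexity survives the Bellman operator: `T` and the active branch are affine, and a maximum of
convex functions is convex. -/
lemma SolvesDP.le_convexComb {β m M : ℝ} {V : ℝ → ℝ} (hV : a.SolvesDP β m 0 V) (hβ : 0 ≤ β)
    (hβ1 : β < 1) (hM : ∀ ω ∈ Icc (0 : ℝ) 1, |V ω| ≤ M) {x y l : ℝ}
    (hx : x ∈ Icc (0 : ℝ) 1) (hy : y ∈ Icc (0 : ℝ) 1) (hl : l ∈ Icc (0 : ℝ) 1) :
    V (l * x + (1 - l) * y) ≤ l * V x + (1 - l) * V y := by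
  refine le_of_forall_le_add_pow_mul (M := 2 * M) hβ hβ1 fun n => ?_
  have hM0 : 0 ≤ M := (abs_nonneg _).trans (hM x hx)
  have hmem : ∀ {x y : ℝ}, x ∈ Icc (0 : ℝ) 1 → y ∈ Icc (0 : ℝ) 1 →
      l * x + (1 - l) * y ∈ Icc (0 : ℝ) 1 := fun {x y} hx hy =>
    convex_Icc (0 : ℝ) 1 hx hy hl.1 (sub_nonneg.2 hl.2) (by ring)
  induction n generalizing x y with
  | zero =>
    have h1 := abs_convexComb_le hl (hM x hx) (hM y hy)
    have h2 := (abs_le.1 (hM _ (hmem hx hy))).2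
    have h3 := (abs_le.1 h1).1
    rw [pow_zero]
    linarith
  | succ n ih =>
    have hx1 := hV x hx
    have hy1 := hV y hy
    have hz1 := hV _ (hmem hx hy)
    rw [zero_add] at hx1 hy1 hz1
    rw [hz1]
    have hl' := sub_nonneg.2 hl.2
    refine max_le ?_ ?_
    · have h1 := mul_le_mul_of_nonneg_left (ih (T_mem (a := a) hx) (T_mem (a := a) hy)) hβ
      have h2 : a.T (l * x + (1 - l) * y) = l * a.T x + (1 - l) * a.T y := by
        unfold T; ring
      rw [h2, pow_succ]
      have h3 := mul_le_mul_of_nonneg_left (hx1.ge.trans' (le_max_left _ _)) hl.1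
      have h4 := mul_le_mul_of_nonneg_left (hy1.ge.trans' (le_max_left _ _)) hl'
      linarith
    · have h3 := mul_le_mul_of_nonneg_left (hx1.ge.trans' (le_max_right _ _)) hl.1
      have h4 := mul_le_mul_of_nonneg_left (hy1.ge.trans' (le_max_right _ _)) hl'
      have := mul_nonneg (pow_nonneg hβ (n + 1)) hM0
      linarith

/-- A bound for the value function on the belief space. -/
lemma abs_discountedValue_le (a : Arm) {β : ℝ} (m : ℝ) (hβ : 0 ≤ β) (hβ1 : β < 1) :
    ∀ ω ∈ Icc (0 : ℝ) 1, |a.discountedValue β m ω| ≤ max |m| a.B / (1 - β) := fun x hx => by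
  rw [le_div_iff₀ (sub_pos.2 hβ1), mul_comm]
  exact (a.solvesDP_discountedValue m hβ hβ1).2 x hx

/-- Being passive is suboptimal under a negative subsidy. -/
lemma nonneg_of_mem_discountedPassiveSet {β m ω : ℝ} (hβ : 0 ≤ β) (hβ1 : β < 1)
    (h : ω ∈ a.discountedPassiveSet β m) : 0 ≤ m := by
  obtain ⟨hω, h⟩ := h
  -- `T ω` is the mixture of `p11` and `p01` with weight `ω`: by convexity, observing the state
  -- never lowers the continuation value.
  have h1 := (a.solvesDP_discountedValue m hβ hβ1).1.le_convexComb hβ hβ1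
    (a.abs_discountedValue_le m hβ hβ1) a.p11_mem a.p01_mem hω
  have h2 := mul_le_mul_of_nonneg_left h1 hβ
  have h3 := mul_nonneg hω.1 a.B_pos.le
  unfold discountedActive discountedPassive T at h
  linarith

/-- Being passive is optimal under a subsidy that is at least `B`. -/
lemma mem_discountedPassiveSet_of_le {β m ω : ℝ} (hβ : 0 ≤ β) (hβ1 : β < 1) (hm : a.B ≤ m)
    (hω : ω ∈ Icc (0 : ℝ) 1) : ω ∈ a.discountedPassiveSet β m := by
  have h1 : (1 - β) ≠ 0 := (sub_pos.2 hβ1).ne'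
  have hB : ∀ ω ∈ Icc (0 : ℝ) 1, ω * a.B ≤ m := fun ω hω =>
    (mul_le_of_le_one_left a.B_pos.le hω.2).trans hm
  have hV : a.SolvesDP β m 0 fun _ => m / (1 - β) := fun x hx => by
    rw [max_eq_left]
    · field_simp; ring
    · have := hB x hx
      linarith
  have he : ∀ x ∈ Icc (0 : ℝ) 1, a.discountedValue β m x = m / (1 - β) := fun x hx =>
    hV.discountedValue_eq (M := |m / (1 - β)|) hβ hβ1 (fun _ _ => le_rfl) hx
  refine ⟨hω, ?_⟩
  unfold discountedActive discountedPassive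
  rw [he _ (T_mem hω), he _ a.p11_mem, he _ a.p01_mem]
  have := hB ω hω
  linarith

/-! ### The vanishing discount limit -/

/-- `T` is affine with slope `p11 - p01`; slope `1` would make both states absorbing, and slope `-1`
is the deterministic flip. -/
lemma abs_corr_lt_one_or (ha : a.NoAbsorbingState) :
    |a.p11 - a.p01| < 1 ∨ (a.p01 = 1 ∧ a.p11 = 0) := by
  have hp := a.p01_mem
  have hq := a.p11_mem
  have := ha.p01_pos
  have := ha.p11_lt_one
  rcases abs_corr_le.lt_or_eq (a := |a.p11 - a.p01|) with h | h
  · exact Or.inl h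
  · right
    rcases abs_cases (a.p11 - a.p01) with ⟨h1, -⟩ | ⟨h1, -⟩
    · linarith [hq.1]
    · constructor <;> linarith [hp.2, hq.1]

/-- The value functions are Lipschitz on the belief space, uniformly in the discount factor. -/
lemma exists_lipschitz_discountedValue (ha : a.NoAbsorbingState) (C : ℝ) :
    ∃ K : ℝ, 0 ≤ K ∧ ∀ β m : ℝ, 0 ≤ β → β < 1 → |m| ≤ C →
      ∀ x ∈ Icc (0 : ℝ) 1, ∀ y ∈ Icc (0 : ℝ) 1,
        |a.discountedValue β m x - a.discountedValue β m y| ≤ K * |x - y| := by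
  have key : ∀ β m : ℝ, 0 ≤ β → β < 1 → ∀ x ∈ Icc (0 : ℝ) 1, ∀ y ∈ Icc (0 : ℝ) 1,
      |a.discountedValue β m x - a.discountedValue β m y| ≤
        |a.B + β * (a.discountedValue β m a.p11 - a.discountedValue β m a.p01)| * |x - y| :=
    fun β m hβ hβ1 x hx y hy => (a.solvesDP_discountedValue m hβ hβ1).1.abs_sub_le hβ hβ1
      (a.abs_discountedValue_le m hβ hβ1) hx hy
  have slope : ∀ β m : ℝ, 0 ≤ β → β < 1 →
      |a.B + β * (a.discountedValue β m a.p11 - a.discountedValue β m a.p01)| ≤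
        a.B + |a.discountedValue β m a.p11 - a.discountedValue β m a.p01| := by
    intro β m hβ hβ1
    refine (abs_add_le _ _).trans ?_
    rw [abs_of_pos a.B_pos, abs_mul, abs_of_nonneg hβ]
    have := mul_le_of_le_one_left
      (abs_nonneg (a.discountedValue β m a.p11 - a.discountedValue β m a.p01)) hβ1.le
    linarith
  rcases abs_corr_lt_one_or ha with hd | ⟨hp, hq⟩
  -- Applied to `p11` and `p01` themselves, `key` bounds the slope by `B` plus `|p11 - p01|` times
  -- itself.
  · have hd' := sub_pos.2 hd
    refine ⟨a.B / (1 - |a.p11 - a.p01|), (div_pos a.B_pos hd').le, fun β m hβ hβ1 _ x hx y hy =>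
      (key β m hβ hβ1 x hx y hy).trans (mul_le_mul_of_nonneg_right ?_ (abs_nonneg _))⟩
    rw [le_div_iff₀ hd']
    have h1 := key β m hβ hβ1 _ a.p11_mem _ a.p01_mem
    have h2 := slope β m hβ hβ1
    linarith
  · have hB := a.B_pos
    refine ⟨a.B + 2 * max C a.B, by linarith [le_max_right C a.B],
      fun β m hβ hβ1 hm x hx y hy =>
      (key β m hβ hβ1 x hx y hy).trans (mul_le_mul_of_nonneg_right
        ((slope β m hβ hβ1).trans (add_le_add_right ?_ _)) (abs_nonneg _))⟩
    -- For the flip, `T` exchanges `0` and `1`; the two passive inequalities and the bound on `(1 -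
    -- β) V` control `V 0 - V 1`. Here the bound on the subsidy enters.
    have hm' : max |m| a.B ≤ max C a.B := max_le_max_right _ hm
    have T0 : a.T 0 = 1 := by simp [T, hp, hq]
    have T1 : a.T 1 = 0 := by simp [T, hq]
    have m0 : (0 : ℝ) ∈ Icc (0 : ℝ) 1 := by simp
    have m1 : (1 : ℝ) ∈ Icc (0 : ℝ) 1 := by simp
    obtain ⟨hV, hb⟩ := a.solvesDP_discountedValue m hβ hβ1
    have e0 := (hV 0 m0).ge.trans' (le_max_left _ _)
    have e1 := (hV 1 m1).ge.trans' (le_max_left _ _)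
    rw [T0] at e0
    rw [T1] at e1
    rw [hp, hq]
    have b0 := hb 0 m0
    have b1 := hb 1 m1
    have hβ' := sub_nonneg.2 hβ1.le
    have c0 := mul_le_mul_of_nonneg_left (le_abs_self (a.discountedValue β m 0)) hβ'
    have c1 := mul_le_mul_of_nonneg_left (le_abs_self (a.discountedValue β m 1)) hβ'
    have d := neg_abs_le m
    have d' := le_max_left |m| a.B
    rw [abs_le]
    constructor <;> linarith

/-- With an ultrafilter, compactness gives limits at all beliefs simultaneously, without a diagonal
argument. -/
lemma exists_tendsto_of_eventually_abs_le {U : Ultrafilter ℝ} {F : ℝ → ℝ} {K : ℝ}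
    (h : ∀ᶠ β in (U : Filter ℝ), |F β| ≤ K) : ∃ l, Tendsto F U (𝓝 l) := by
  obtain ⟨l, -, hl⟩ := (isCompact_Icc (a := -K) (b := K)).ultrafilter_le_nhds (U.map F) (by
    have : ∀ᶠ β in (U : Filter ℝ), F β ∈ Icc (-K) K := h.mono fun β hβ => abs_le.1 hβ
    exact le_principal_iff.2 this)
  exact ⟨l, hl⟩

/-- Along an ultrafilter of discount factors tending to `1`, the normalized value functions
converge to a relative value function. -/
lemma exists_solvesDP_of_tendsto (ha : a.NoAbsorbingState) {U : Ultrafilter ℝ}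
    (hU : (U : Filter ℝ) ≤ 𝓝[<] 1) {μ : ℝ → ℝ} {m : ℝ} (hμ : Tendsto μ U (𝓝 m)) :
    ∃ (g : ℝ) (h : ℝ → ℝ), a.SolvesDP 1 m g h ∧ ContinuousOn h (Icc 0 1) ∧
      ∀ ω ∈ Icc (0 : ℝ) 1,
        ((∀ᶠ β in (U : Filter ℝ), a.discountedActive β (μ β) ω ≤ a.discountedPassive β (μ β) ω) →
          a.averageActive h ω ≤ a.averagePassive m h ω) ∧
        ((∀ᶠ β in (U : Filter ℝ), a.discountedPassive β (μ β) ω ≤ a.discountedActive β (μ β) ω) →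
          a.averagePassive m h ω ≤ a.averageActive h ω) := by
  have hβt : Tendsto (fun β : ℝ => β) U (𝓝 1) := hU.trans nhdsWithin_le_nhds
  have hβ : ∀ᶠ β in (U : Filter ℝ), 0 ≤ β ∧ β < 1 := by
    refine hU ?_
    filter_upwards [Ioo_mem_nhdsLT (zero_lt_one (α := ℝ))] with β h using ⟨h.1.le, h.2⟩
  have hμb : ∀ᶠ β in (U : Filter ℝ), |μ β| ≤ |m| + 1 :=
    (hμ.abs.eventually_lt_const (lt_add_one _)).mono fun _ h => h.le
  obtain ⟨K, hK0, hK⟩ := exists_lipschitz_discountedValue ha (|m| + 1)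
  have hlim : ∀ ω : ℝ, ∃ l, ω ∈ Icc (0 : ℝ) 1 → Tendsto (fun β =>
      a.discountedValue β (μ β) ω - a.discountedValue β (μ β) a.p01) U (𝓝 l) := by
    intro ω
    by_cases hω : ω ∈ Icc (0 : ℝ) 1
    · obtain ⟨l, hl⟩ := exists_tendsto_of_eventually_abs_le (U := U) (K := K) (F := fun β =>
        a.discountedValue β (μ β) ω - a.discountedValue β (μ β) a.p01) (by
          filter_upwards [hβ, hμb] with β h1 h2
          refine (hK β _ h1.1 h1.2 h2 ω hω _ a.p01_mem).trans (mul_le_of_le_one_right hK0 ?_)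
          have := a.p01_mem
          rw [abs_le]
          constructor <;> linarith [this.1, this.2, hω.1, hω.2])
      exact ⟨l, fun _ => hl⟩
    · exact ⟨0, fun h => absurd h hω⟩
  choose h hh using hlim
  obtain ⟨g, hg⟩ := exists_tendsto_of_eventually_abs_le (U := U) (K := max (|m| + 1) a.B)
    (F := fun β => (1 - β) * a.discountedValue β (μ β) a.p01) (by
      filter_upwards [hβ, hμb] with β h1 h2
      rw [abs_mul, abs_of_nonneg (sub_nonneg.2 h1.2.le)]
      exact ((a.solvesDP_discountedValue (μ β) h1.1 h1.2).2 _ a.p01_mem).trans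
        (max_le_max_right _ h2))
  -- Subtracting `β V(p01)` from both branches preserves their comparison, and `V(ω) - β V(p01) = (1
  -- - β) V(p01) + (V(ω) - V(p01))` makes every term converge, with gain `g = lim (1 - β) V(p01)`.
  have hP : ∀ ω ∈ Icc (0 : ℝ) 1, Tendsto (fun β => a.discountedPassive β (μ β) ω -
      β * a.discountedValue β (μ β) a.p01) U (𝓝 (a.averagePassive m h ω)) := by
    intro ω hω
    have := hμ.add (hβt.mul (hh _ (T_mem (a := a) hω)))
    rw [one_mul] at this
    refine this.congr fun β => ?_
    unfold discountedPassive
    ring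
  have hA : ∀ ω ∈ Icc (0 : ℝ) 1, Tendsto (fun β => a.discountedActive β (μ β) ω -
      β * a.discountedValue β (μ β) a.p01) U (𝓝 (a.averageActive h ω)) := by
    intro ω hω
    have := (hβt.mul (((hh _ a.p11_mem).const_mul ω).add
      ((hh _ a.p01_mem).const_mul (1 - ω)))).const_add (ω * a.B)
    rw [one_mul] at this
    refine this.congr fun β => ?_
    unfold discountedActive
    ring
  refine ⟨g, h, fun ω hω => ?_, ?_, fun ω hω => ⟨fun hd => ?_, fun hd => ?_⟩⟩
  · have h1 := hg.add (hh ω hω)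
    have h2 := (hP ω hω).max (hA ω hω)
    have h3 : (max (m + 1 * h (a.T ω)) (ω * a.B + 1 * (ω * h a.p11 + (1 - ω) * h a.p01))) =
        max (a.averagePassive m h ω) (a.averageActive h ω) := by
      simp [averagePassive, averageActive]
    rw [h3]
    refine tendsto_nhds_unique (h1.congr' ?_) h2
    filter_upwards [hβ] with β h4
    have h5 := (a.solvesDP_discountedValue (μ β) h4.1 h4.2).1 ω hω
    rw [max_sub_sub_right]
    unfold discountedPassive discountedActive
    rw [← h5]
    ring
  · have : LipschitzOnWith ⟨K, hK0⟩ h (Icc 0 1) := by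
      refine LipschitzOnWith.of_dist_le_mul fun x hx y hy => ?_
      rw [Real.dist_eq, Real.dist_eq]
      refine le_of_tendsto ((hh x hx).sub (hh y hy)).abs ?_
      filter_upwards [hβ, hμb] with β h1 h2
      rw [sub_sub_sub_cancel_right]
      exact hK β _ h1.1 h1.2 h2 x hx y hy
    exact this.continuousOn
  · exact le_of_tendsto_of_tendsto (hA ω hω) (hP ω hω) (hd.mono fun β h => sub_le_sub_right h _)
  · exact le_of_tendsto_of_tendsto (hP ω hω) (hA ω hω) (hd.mono fun β h => sub_le_sub_right h _)

lemma exists_isRelativeValue (ha : a.NoAbsorbingState) (m : ℝ) :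
    ∃ h : ℝ → ℝ, a.IsRelativeValue m h := by
  obtain ⟨g, h, h1, h2, -⟩ := exists_solvesDP_of_tendsto ha (U := Ultrafilter.of (𝓝[<] 1))
    (Ultrafilter.of_le _) (tendsto_const_nhds (x := m))
  exact ⟨h, h1.isRelativeValue h2⟩

/-! ### Iterates of the belief update -/

lemma NoAbsorbingState.corr_lt_one (ha : a.NoAbsorbingState) : a.p11 - a.p01 < 1 := by
  linarith [ha.p01_pos, ha.p11_lt_one]

lemma stationary_mul (ha : a.NoAbsorbingState) :
    a.stationary * (1 - (a.p11 - a.p01)) = a.p01 := by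
  have h : a.p01 + a.p10 ≠ 0 := by
    unfold p10; linarith [ha.corr_lt_one]
  have : 1 - (a.p11 - a.p01) = a.p01 + a.p10 := by unfold p10; ring
  rw [this, stationary, div_mul_cancel₀ _ h]

lemma T_sub_self (ha : a.NoAbsorbingState) (ω : ℝ) :
    a.T ω - ω = (a.stationary - ω) * (1 - (a.p11 - a.p01)) := by
  rw [sub_mul, stationary_mul ha]
  unfold T; ring

lemma T_stationary (ha : a.NoAbsorbingState) : a.T a.stationary = a.stationary := by
  have := T_sub_self ha a.stationary
  rw [sub_self, zero_mul] at this
  linarith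

lemma stationary_mem (ha : a.NoAbsorbingState) : a.stationary ∈ Icc (0 : ℝ) 1 := by
  have h1 := stationary_mul ha
  have h2 := sub_pos.2 ha.corr_lt_one
  have h3 := ha.p01_pos
  have h4 := ha.p11_lt_one
  constructor <;> nlinarith

lemma iterate_T_sub_stationary (ha : a.NoAbsorbingState) (ω : ℝ) (k : ℕ) :
    a.T^[k] ω - a.stationary = (a.p11 - a.p01) ^ k * (ω - a.stationary) := by
  induction k with
  | zero => simp
  | succ k ih =>
    rw [Function.iterate_succ_apply']
    have := T_sub_T (a := a) (a.T^[k] ω) a.stationary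
    rw [T_stationary ha, ih] at this
    rw [this, pow_succ]; ring

lemma iterate_T_sub_self (ha : a.NoAbsorbingState) (ω : ℝ) (k : ℕ) :
    a.T^[k] ω - ω = (a.stationary - ω) * (1 - (a.p11 - a.p01) ^ k) := by
  linear_combination iterate_T_sub_stationary ha ω k

lemma corr_pow_le_one (k : ℕ) : (a.p11 - a.p01) ^ k ≤ 1 := by
  refine (le_abs_self _).trans ?_
  rw [abs_pow]
  exact pow_le_one₀ (abs_nonneg _) abs_corr_le

/-- Bernoulli's inequality, valid for negative correlation too. -/
lemma one_sub_corr_pow_le (k : ℕ) :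
    1 - (a.p11 - a.p01) ^ k ≤ k * (1 - (a.p11 - a.p01)) := by
  have h := (abs_le.1 (abs_corr_le (a := a))).1
  have := one_add_mul_le_pow (a := a.p11 - a.p01 - 1) (by linarith) k
  rw [add_sub_cancel] at this
  linarith

lemma iterate_T_le_of_stationary_le (ha : a.NoAbsorbingState) {ω : ℝ} (h : a.stationary ≤ ω)
    (k : ℕ) : a.T^[k] ω ≤ ω := by
  have h1 := iterate_T_sub_self ha ω k
  have h2 := mul_nonneg (sub_nonneg.2 h) (sub_nonneg.2 (corr_pow_le_one (a := a) k))
  linarith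

lemma iterate_T_sub_le (ha : a.NoAbsorbingState) {ω : ℝ} (h : ω ≤ a.stationary) (k : ℕ) :
    a.T^[k] ω - ω ≤ k * (a.T ω - ω) := by
  rw [iterate_T_sub_self ha, T_sub_self ha]
  have := mul_le_mul_of_nonneg_left (one_sub_corr_pow_le (a := a) k) (sub_nonneg.2 h)
  linarith

lemma tendsto_iterate_T (ha : a.NoAbsorbingState) (hd : |a.p11 - a.p01| < 1) {f : ℝ → ℝ}
    (hf : ContinuousOn f (Icc 0 1)) {ω : ℝ} (hω : ω ∈ Icc (0 : ℝ) 1) :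
    Tendsto (fun k => f (a.T^[k] ω)) atTop (𝓝 (f a.stationary)) := by
  refine (hf _ (stationary_mem ha)).tendsto.comp (tendsto_nhdsWithin_iff.2
    ⟨?_, Eventually.of_forall fun k => iterate_T_mem hω k⟩)
  have h1 := ((tendsto_pow_atTop_nhds_zero_of_abs_lt_one hd).mul_const
    (ω - a.stationary)).const_add a.stationary
  rw [zero_mul, add_zero] at h1
  exact h1.congr fun k => by linarith [iterate_T_sub_stationary ha ω k]

/-! ### The normal form of the average reward dynamic programming equation -/

/-- `f` is the value of stopping the passive belief process, where stopping at belief `ω` pays `ω`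
and each step costs `v`. -/
def SolvesStopping (a : Arm) (v : ℝ) (f : ℝ → ℝ) : Prop :=
  ∀ ω ∈ Icc (0 : ℝ) 1, f ω = max (f (a.T ω) - v) ω

lemma exists_nat_mul_gt {u : ℝ} (hu : 0 < u) (x : ℝ) : ∃ k : ℕ, x < k * u := by
  obtain ⟨k, hk⟩ := exists_nat_gt (x / u)
  exact ⟨k, (div_lt_iff₀ hu).1 hk⟩

/-- Suppose `s ≤ 0`. Activating at `p11` forces `g > 0`. Activating anywhere on the orbit of `p01`
then returns at most `h(p01)` and loses `g`, so waiting forever is optimal from `p01`. If `g > m`,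
this makes `h` unbounded. If `g = m`, it gives `h(p01) ≤ h(ω_o) ≤ h(p11)` (for the flip, `T p11 =
p01` gives `h(p01) ≤ h(p11)` at once), whence `s ≥ B`. -/
lemma SolvesDP.slope_pos {m g : ℝ} {h : ℝ → ℝ} (ha : a.NoAbsorbingState)
    (hV : a.SolvesDP 1 m g h) (hc : ContinuousOn h (Icc 0 1)) (hu : 0 ≤ g - m) :
    0 < a.B + h a.p11 - h a.p01 := by
  by_contra! hs
  set s := a.B + h a.p11 - h a.p01 with hs_def
  have hB := a.B_pos
  have hP : ∀ ω ∈ Icc (0 : ℝ) 1, h (a.T ω) - (g - m) ≤ h ω := fun ω hω => by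
    have := (hV ω hω).ge.trans' (le_max_left _ _)
    linarith
  have hg : 0 < g := by
    by_contra! hg
    have h1 := (hV _ a.p11_mem).ge.trans' (le_max_right _ _)
    have h2 := mul_nonneg (sub_nonneg.2 a.p11_mem.2) (neg_nonneg.2 hs)
    rw [hs_def] at h2
    linarith
  have hiter : ∀ k : ℕ, h a.p01 ≤
      max (h (a.T^[k] a.p01) - k * (g - m)) (h a.p01 - g) := by
    intro k
    induction k with
    | zero => simp
    | succ k ih =>
      refine ih.trans (max_le ?_ (le_max_right _ _))
      have hmem := iterate_T_mem (a := a) a.p01_mem k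
      have h1 := hV _ hmem
      rw [Function.iterate_succ_apply']
      have h2 := mul_nonneg (Nat.cast_nonneg (α := ℝ) k) hu
      rcases max_choice (m + 1 * h (a.T (a.T^[k] a.p01)))
        (a.T^[k] a.p01 * a.B + 1 * (a.T^[k] a.p01 * h a.p11 + (1 - a.T^[k] a.p01) * h a.p01))
        with h3 | h3
      · refine le_max_of_le_left ?_
        rw [h3] at h1
        push_cast
        linarith
      · refine le_max_of_le_right ?_
        rw [h3] at h1
        have h4 := mul_nonneg hmem.1 (neg_nonneg.2 hs)
        rw [hs_def] at h4
        linarith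
  have hiter' : ∀ k : ℕ, h a.p01 ≤ h (a.T^[k] a.p01) - k * (g - m) := fun k => by
    rcases le_max_iff.1 (hiter k) with h1 | h1
    · exact h1
    · linarith
  rcases hu.lt_or_eq with hu | hu
  · obtain ⟨M, hM⟩ := isCompact_Icc.exists_bound_of_continuousOn hc
    obtain ⟨k, hk⟩ := exists_nat_mul_gt hu (M - h a.p01)
    have h1 := (abs_le.1 (hM _ (iterate_T_mem (a := a) a.p01_mem k))).2
    linarith [hiter' k]
  · rw [← hu] at hP hiter'
    rcases abs_corr_lt_one_or ha with hd | ⟨hp, hq⟩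
    · have h1 : h a.p01 ≤ h a.stationary :=
        ge_of_tendsto' (tendsto_iterate_T ha hd hc a.p01_mem) fun k => by
          simpa using hiter' k
      have h2 : h a.stationary ≤ h a.p11 := by
        refine le_of_tendsto' (tendsto_iterate_T ha hd hc a.p11_mem) fun k => ?_
        induction k with
        | zero => exact le_rfl
        | succ k ih =>
          rw [Function.iterate_succ_apply']
          linarith [hP _ (iterate_T_mem (a := a) a.p11_mem k)]
      linarith
    · have h1 := hP _ a.p11_mem
      have h2 : a.T a.p11 = a.p01 := by simp [T, hp, hq]
      rw [h2] at h1
      linarith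

/-- Every solution of the average reward dynamic programming equation is an affine image of the
value of a stopping problem. -/
lemma SolvesDP.exists_stopping {m g : ℝ} {h : ℝ → ℝ} (ha : a.NoAbsorbingState)
    (hV : a.SolvesDP 1 m g h) (hc : ContinuousOn h (Icc 0 1)) :
    ∃ (s v : ℝ) (f : ℝ → ℝ), 0 < s ∧ 0 ≤ v ∧ ContinuousOn f (Icc 0 1) ∧ a.SolvesStopping v f ∧
      0 < 1 + f a.p01 - f a.p11 ∧ m * (1 + f a.p01 - f a.p11) = a.B * (f a.p01 - v) ∧
      ∀ ω, a.averageActive h ω - a.averagePassive m h ω = s * (ω - (f (a.T ω) - v)) := by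
  -- Staying passive at the fixed point of `T` earns `m` in every slot.
  have hu : 0 ≤ g - m := by
    have h1 := (hV _ (stationary_mem ha)).ge.trans' (le_max_left _ _)
    rw [T_stationary ha] at h1
    linarith
  have hs := hV.slope_pos ha hc hu
  set s := a.B + h a.p11 - h a.p01 with hs_def
  have hD : 1 + (h a.p01 - h a.p01 + g) / s - (h a.p11 - h a.p01 + g) / s = a.B / s := by
    field_simp
    rw [hs_def]; ring
  refine ⟨s, (g - m) / s, fun ω => (h ω - h a.p01 + g) / s, hs, div_nonneg hu hs.le, ?_, ?_, ?_,
    ?_, ?_⟩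
  · fun_prop
  · intro ω hω
    have h1 := hV ω hω
    have h2 : (h (a.T ω) - h a.p01 + g) / s - (g - m) / s =
        (m + 1 * h (a.T ω) - h a.p01) / s := by ring
    have h3 : ω = (ω * a.B + 1 * (ω * h a.p11 + (1 - ω) * h a.p01) - h a.p01) / s := by
      rw [eq_div_iff hs.ne', hs_def]; ring
    change (h ω - h a.p01 + g) / s = max ((h (a.T ω) - h a.p01 + g) / s - (g - m) / s) ω
    rw [h2]
    conv_rhs => rw [h3]
    rw [max_div_div_right hs.le, max_sub_sub_right, ← h3, ← h1]
    ring
  · simp only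
    rw [hD]
    exact div_pos a.B_pos hs
  · simp only
    rw [hD]
    ring
  · intro ω
    simp only [averageActive, averagePassive]
    have : s * (ω - ((h (a.T ω) - h a.p01 + g) / s - (g - m) / s)) =
        s * ω - (h (a.T ω) - h a.p01 + g) + (g - m) := by
      field_simp
      ring
    rw [this, hs_def]; ring

/-- The payoffs available in the stopping problem from the initial belief `x`; if waiting is free,
never stopping is allowed and pays `θ`. -/
def stopPayoffs (a : Arm) (v θ x : ℝ) : Set ℝ :=
  {y | (∃ k : ℕ, y = a.T^[k] x - k * v) ∨ (v = 0 ∧ y = θ)}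

lemma SolvesStopping.le_iterate {v : ℝ} {f : ℝ → ℝ} (hf : a.SolvesStopping v f) {x : ℝ}
    (hx : x ∈ Icc (0 : ℝ) 1) (k : ℕ) : f (a.T^[k] x) - k * v ≤ f x := by
  induction k with
  | zero => simp
  | succ k ih =>
    have := (hf _ (iterate_T_mem (a := a) hx k)).ge.trans' (le_max_left _ _)
    rw [Function.iterate_succ_apply']
    push_cast
    linarith

lemma SolvesStopping.self_le {v : ℝ} {f : ℝ → ℝ} (hf : a.SolvesStopping v f) {x : ℝ}
    (hx : x ∈ Icc (0 : ℝ) 1) : x ≤ f x := (hf x hx).ge.trans' (le_max_right _ _)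

/-- Either stopping is optimal at some finite time, or `f(x) = f(T^k x) - k v` for all `k`. The
latter contradicts boundedness if `v > 0`; if `v = 0`, the orbit converges and `f(x)` equals `f` at
the stationary belief. -/
lemma SolvesStopping.isGreatest {v : ℝ} {f : ℝ → ℝ} (ha : a.NoAbsorbingState) (hv : 0 ≤ v)
    (hf : a.SolvesStopping v f) (hc : ContinuousOn f (Icc 0 1))
    (hvd : 0 < v ∨ |a.p11 - a.p01| < 1) {x : ℝ} (hx : x ∈ Icc (0 : ℝ) 1) :
    IsGreatest (a.stopPayoffs v (f a.stationary) x) (f x) := by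
  constructor
  · by_cases hk : ∃ k : ℕ, f x = a.T^[k] x - k * v
    · exact Or.inl hk
    push Not at hk
    have heq : ∀ k : ℕ, f x = f (a.T^[k] x) - k * v := by
      intro k
      induction k with
      | zero => simp
      | succ k ih =>
        have h1 := hf _ (iterate_T_mem (a := a) hx k)
        rcases max_choice (f (a.T (a.T^[k] x)) - v) (a.T^[k] x) with h2 | h2
        · rw [Function.iterate_succ_apply']
          rw [h2] at h1
          push_cast
          linarith
        · rw [h2] at h1
          exact absurd (by rw [ih, h1]) (hk k)
    rcases hv.lt_or_eq with hv | hv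
    · obtain ⟨M, hM⟩ := isCompact_Icc.exists_bound_of_continuousOn hc
      obtain ⟨k, hk⟩ := exists_nat_mul_gt hv (M - f x)
      have h1 := (abs_le.1 (hM _ (iterate_T_mem (a := a) hx k))).2
      linarith [heq k]
    · subst hv
      refine Or.inr ⟨rfl, ?_⟩
      have hd := hvd.resolve_left (lt_irrefl _)
      refine tendsto_nhds_unique (tendsto_const_nhds.congr fun k => ?_)
        (tendsto_iterate_T ha hd hc hx)
      have := heq k
      rwa [mul_zero, sub_zero] at this
  · rintro y (⟨k, rfl⟩ | ⟨hv0, rfl⟩)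
    · have h1 := hf.le_iterate hx k
      have h2 := hf.self_le (iterate_T_mem (a := a) hx k)
      linarith
    · subst hv0
      refine le_of_tendsto' (tendsto_iterate_T ha (hvd.resolve_left (lt_irrefl _)) hc hx)
        fun k => ?_
      simpa using hf.le_iterate hx k

/-- One-step lookahead: if one step does not repay its cost, no longer wait does. Above the
stationary belief the orbit never exceeds its start; below it, `k` steps gain at most `k` times the
first. -/
lemma iterate_succ_T_sub_lt (ha : a.NoAbsorbingState) {v ω : ℝ} (hv : 0 < v)
    (h : a.T ω - ω < v) (k : ℕ) : a.T^[k] (a.T ω) - k * v - v < ω := by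
  rw [← Function.iterate_succ_apply]
  rcases le_total a.stationary ω with h1 | h1
  · have h2 := iterate_T_le_of_stationary_le ha h1 (k + 1)
    have h3 := mul_nonneg (Nat.cast_nonneg (α := ℝ) k) hv.le
    linarith
  · have h2 := iterate_T_sub_le ha h1 (k + 1)
    have h3 := mul_lt_mul_of_pos_left h (Nat.cast_add_one_pos (α := ℝ) k)
    push_cast at h2
    linarith

lemma iterate_succ_T_lt (ha : a.NoAbsorbingState) (hd : |a.p11 - a.p01| < 1) {ω : ℝ}
    (h : a.stationary < ω) (k : ℕ) : a.T^[k] (a.T ω) < ω := by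
  rw [← Function.iterate_succ_apply]
  have h1 := iterate_T_sub_self ha ω (k + 1)
  have h2 : (a.p11 - a.p01) ^ (k + 1) < 1 := by
    refine (le_abs_self _).trans_lt ?_
    rw [abs_pow]
    exact pow_lt_one₀ (abs_nonneg _) hd (Nat.succ_ne_zero k)
  have h3 := mul_pos (sub_pos.2 h) (sub_pos.2 h2)
  linarith

/-! ### Comparison of thresholds -/

/-- Waiting cost that makes the belief `ω` indifferent. -/
def waitCost (a : Arm) (ω : ℝ) : ℝ := max (a.T ω - ω) 0

lemma le_of_isGreatest_stopPayoffs {v θ v' θ' x y y' : ℝ} (hv' : 0 ≤ v') (hv : v' ≤ v)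
    (hθ : v = 0 → θ ≤ θ') (hy : IsGreatest (a.stopPayoffs v θ x) y)
    (hy' : IsGreatest (a.stopPayoffs v' θ' x) y') : y ≤ y' := by
  rcases hy.1 with ⟨k, rfl⟩ | ⟨h0, rfl⟩
  · refine le_trans ?_ (hy'.2 (Or.inl ⟨k, rfl⟩))
    have := mul_le_mul_of_nonneg_left hv (Nat.cast_nonneg (α := ℝ) k)
    linarith
  · exact (hθ h0).trans (hy'.2 (Or.inr ⟨le_antisymm (hv.trans h0.le) hv', rfl⟩))

/-- The index is monotone in the threshold. -/
lemma stopping_ratio_mono {v θ v' θ' A b A' b' : ℝ} (hv' : 0 ≤ v') (hv : v' ≤ v)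
    (hθ : v = 0 → θ ≤ θ')
    (hA : IsGreatest (a.stopPayoffs v θ a.p01) A) (hb : IsGreatest (a.stopPayoffs v θ a.p11) b)
    (hA' : IsGreatest (a.stopPayoffs v' θ' a.p01) A')
    (hb' : IsGreatest (a.stopPayoffs v' θ' a.p11) b')
    (hN : 0 ≤ A - v) (hND : A - v ≤ 1 + A - b) :
    (A - v) * (1 + A' - b') ≤ (A' - v') * (1 + A - b) := by
  have h1 := le_of_isGreatest_stopPayoffs hv' hv hθ hA hA'
  have h2 := le_of_isGreatest_stopPayoffs hv' hv hθ hb hb'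
  -- With `N = A - v` and `D = 1 + A - b`, the difference of the two sides is `(A' - A)(D - N) + (v
  -- - v') D + N (b' - b)`.
  have h3 := mul_nonneg (sub_nonneg.2 h1) (sub_nonneg.2 hND)
  have h4 := mul_nonneg (sub_nonneg.2 hv) (hN.trans hND)
  have h5 := mul_nonneg hN (sub_nonneg.2 h2)
  linarith

lemma stopPayoffs_le {v θ x y : ℝ} (hv : 0 ≤ v) (hx : x ∈ Icc (0 : ℝ) 1)
    (hθ : v = 0 → θ ≤ 1) (hy : y ∈ a.stopPayoffs v θ x) : y ≤ 1 := by
  rcases hy with ⟨k, rfl⟩ | ⟨h0, rfl⟩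
  · have h1 := (iterate_T_mem (a := a) hx k).2
    have h2 := mul_nonneg (Nat.cast_nonneg (α := ℝ) k) hv
    linarith
  · exact hθ h0

lemma waitCost_nonneg (a : Arm) (ω : ℝ) : 0 ≤ a.waitCost ω := le_max_right _ _

/-- All payoffs are at most `1`, stopping at once gives `A ≥ p01 > 0`, and `T ω - ω ≤ p01`. These
bounds also place the index in `[0, B]`. -/
lemma ratio_bounds (ha : a.NoAbsorbingState) {ω A b : ℝ} (hω : ω ∈ Icc (0 : ℝ) 1)
    (hA : IsGreatest (a.stopPayoffs (a.waitCost ω) ω a.p01) A)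
    (hb : IsGreatest (a.stopPayoffs (a.waitCost ω) ω a.p11) b) :
    0 < 1 + A - b ∧ 0 ≤ A - a.waitCost ω ∧ A - a.waitCost ω ≤ 1 + A - b := by
  have h1 := stopPayoffs_le (a.waitCost_nonneg ω) a.p11_mem (fun _ => hω.2) hb.1
  have h2 : a.p01 ≤ A := hA.2 (Or.inl ⟨0, by simp⟩)
  have h3 := ha.p01_pos
  have h4 := a.waitCost_nonneg ω
  refine ⟨by linarith, ?_, by linarith⟩
  refine sub_nonneg.2 (max_le ?_ (by linarith))
  have h5 := mul_nonneg hω.1 (sub_nonneg.2 ha.corr_lt_one.le)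
  unfold T
  linarith

/-- The decision at `ω` under the subsidy `m`, in terms of the index of `ω`. -/
lemma SolvesDP.decision {m g ω A b : ℝ} {h : ℝ → ℝ} (ha : a.NoAbsorbingState)
    (hV : a.SolvesDP 1 m g h) (hc : ContinuousOn h (Icc 0 1)) (hω : ω ∈ Icc (0 : ℝ) 1)
    (hA : IsGreatest (a.stopPayoffs (a.waitCost ω) ω a.p01) A)
    (hb : IsGreatest (a.stopPayoffs (a.waitCost ω) ω a.p11) b) :
    (m < a.B * (A - a.waitCost ω) / (1 + A - b) →
      a.averagePassive m h ω < a.averageActive h ω) ∧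
    (a.B * (A - a.waitCost ω) / (1 + A - b) < m →
      a.averageActive h ω ≤ a.averagePassive m h ω) ∧
    (a.B * (A - a.waitCost ω) / (1 + A - b) < m → m < a.B →
      a.averageActive h ω < a.averagePassive m h ω) := by
  obtain ⟨s, v, f, hs, hv, hfc, hf, hD, hm, hdec⟩ := hV.exists_stopping ha hc
  obtain ⟨hDω, hNω, hNDω⟩ := ratio_bounds ha hω hA hb
  have hB := a.B_pos
  have hWm : a.B * (A - a.waitCost ω) / (1 + A - b) < m ↔
      (A - a.waitCost ω) * (1 + f a.p01 - f a.p11) < (f a.p01 - v) * (1 + A - b) := by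
    rw [div_lt_iff₀ hDω, ← mul_lt_mul_iff_left₀ hD, mul_right_comm m, hm, mul_assoc, mul_assoc,
      mul_lt_mul_iff_right₀ hB]
  have hmW : m < a.B * (A - a.waitCost ω) / (1 + A - b) ↔
      (f a.p01 - v) * (1 + A - b) < (A - a.waitCost ω) * (1 + f a.p01 - f a.p11) := by
    rw [lt_div_iff₀ hDω, ← mul_lt_mul_iff_left₀ hD, mul_right_comm m, hm, mul_assoc, mul_assoc,
      mul_lt_mul_iff_right₀ hB]
  have hact : 0 < ω - (f (a.T ω) - v) → a.averagePassive m h ω < a.averageActive h ω := fun h1 => by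
    have := mul_pos hs h1
    linarith [hdec ω]
  have hpas : 0 ≤ (f (a.T ω) - v) - ω → a.averageActive h ω ≤ a.averagePassive m h ω := fun h1 => by
    have := mul_nonneg hs.le h1
    linarith [hdec ω]
  have hpas' : 0 < (f (a.T ω) - v) - ω → a.averageActive h ω < a.averagePassive m h ω := fun h1 => by
    have := mul_pos hs h1
    linarith [hdec ω]
  have hTω := T_mem (a := a) hω
  by_cases hvd : 0 < v ∨ |a.p11 - a.p01| < 1
  · have hg := fun {x} (hx : x ∈ Icc (0 : ℝ) 1) => hf.isGreatest ha hv hfc hvd hx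
    set θ := f a.stationary with hθ
    have hθs : a.stationary ≤ θ := hf.self_le (stationary_mem ha)
    have strict : a.B * (A - a.waitCost ω) / (1 + A - b) < m →
        a.averageActive h ω < a.averagePassive m h ω := by
      rw [hWm]
      intro hlt
      apply hpas'
      -- If active were weakly optimal, `T ω ≤ f (T ω) ≤ ω + v` would put `v` above the critical
      -- cost (and `θ ≤ ω` if `v = 0`), so monotonicity would bound `m` by the index.
      by_contra! hcon
      have h1 : a.T ω ≤ f (a.T ω) := hf.self_le hTω
      have hvω : a.waitCost ω ≤ v := max_le (by linarith) hv
      have hθω : v = 0 → θ ≤ ω := fun h0 => by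
        have := (hg hTω).2 (Or.inr ⟨h0, rfl⟩)
        linarith
      have hq : f a.p11 ≤ 1 :=
        stopPayoffs_le hv a.p11_mem (fun h0 => (hθω h0).trans hω.2) (hg a.p11_mem).1
      have hN : 0 ≤ f a.p01 - v := by
        by_contra! hneg
        have h2 := mul_pos_of_neg_of_neg hneg (neg_lt_zero.2 hDω)
        have h3 := mul_nonneg hNω hD.le
        linarith
      have := stopping_ratio_mono (a.waitCost_nonneg ω) hvω hθω (hg a.p01_mem) (hg a.p11_mem)
        hA hb hN (by linarith)
      linarith
    refine ⟨?_, fun h1 => (strict h1).le, fun h1 _ => strict h1⟩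
    rw [hmW]
    intro hlt
    apply hact
    -- Conversely, if passive were weakly optimal, one-step lookahead would put `v` below the
    -- critical cost and, where that cost is `0`, `θ` above `ω`.
    by_contra! hcon
    have hvω : v ≤ a.waitCost ω := by
      rcases hv.lt_or_eq with hv | hv
      · refine le_max_of_le_left ?_
        by_contra! hlt'
        rcases (hg hTω).1 with ⟨k, hk⟩ | ⟨h0, -⟩
        · have := iterate_succ_T_sub_lt ha hv hlt' k
          linarith
        · exact hv.ne' h0
      · exact hv ▸ a.waitCost_nonneg ω
    have hθω : a.waitCost ω = 0 → ω ≤ θ := by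
      intro h0
      have hv0 : v = 0 := le_antisymm (hvω.trans h0.le) hv
      by_contra! hlt'
      have hd := hvd.resolve_left hv0.not_gt
      rcases (hg hTω).1 with ⟨k, hk⟩ | ⟨-, hk⟩
      · have := iterate_succ_T_lt ha hd (hθs.trans_lt hlt') k
        rw [hv0, mul_zero, sub_zero] at hk
        linarith
      · linarith
    have := stopping_ratio_mono hv hvω hθω hA hb (hg a.p01_mem) (hg a.p11_mem) hNω hNDω
    linarith
  -- The flip with free waiting: `f 0 = f 1` forces `m = B f(1) ≥ B`, which is at least the index,
  -- so only weak optimality of passive remains to be shown.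
  · push Not at hvd
    obtain rfl : v = 0 := le_antisymm hvd.1 hv
    obtain ⟨hp, hq⟩ := (abs_corr_lt_one_or ha).resolve_left hvd.2.not_gt
    have hT : ∀ x, a.T x = 1 - x := fun x => by simp [T, hp, hq]
    have hsymm : ∀ x ∈ Icc (0 : ℝ) 1, f (a.T x) ≤ f x := fun x hx => by
      have := (hf x hx).ge.trans' (le_max_left _ _)
      linarith
    have h01 : f 0 = f 1 := by
      have h0 := hsymm 0 (by simp)
      have h1 := hsymm 1 (by simp)
      rw [hT] at h0 h1
      norm_num at h0 h1
      exact le_antisymm h1 h0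
    have hmB : a.B ≤ m := by
      rw [hp, hq, h01] at hm
      have h1 : (1 : ℝ) ≤ f 1 := hf.self_le (by simp)
      have := mul_le_mul_of_nonneg_left h1 hB.le
      linarith
    have hWB : a.B * (A - a.waitCost ω) / (1 + A - b) ≤ a.B := by
      rw [div_le_iff₀ hDω]
      exact mul_le_mul_of_nonneg_left hNDω hB.le
    refine ⟨fun h1 => absurd h1 (hWB.trans hmB).not_gt, fun _ => hpas ?_,
      fun _ h1 => absurd h1 hmB.not_gt⟩
    have h1 := hsymm _ hTω
    have h2 : a.T (a.T ω) = ω := by rw [hT, hT]; ring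
    rw [h2] at h1
    linarith [hf.self_le hω]

/-! ### The index in terms of the stopping problem -/

lemma averageWhittleIndex_eq (ha : a.NoAbsorbingState) {ω A b : ℝ} (hω : ω ∈ Icc (0 : ℝ) 1)
    (hA : IsGreatest (a.stopPayoffs (a.waitCost ω) ω a.p01) A)
    (hb : IsGreatest (a.stopPayoffs (a.waitCost ω) ω a.p11) b) :
    a.averageWhittleIndex ω = a.B * (A - a.waitCost ω) / (1 + A - b) := by
  set W := a.B * (A - a.waitCost ω) / (1 + A - b) with hW
  have hmem : ∀ m, W < m → ω ∈ a.averagePassiveSet m := by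
    intro m hm
    obtain ⟨h, hh⟩ := exists_isRelativeValue ha m
    obtain ⟨g, hg⟩ := hh.solvesDP
    exact ⟨hω, h, hh, (hg.decision ha hh.1 hω hA hb).2.1 hm⟩
  refine csInf_eq_of_forall_ge_of_forall_gt_exists_lt ⟨W + 1, hmem _ (lt_add_one W)⟩ ?_ ?_
  · rintro m ⟨-, h, hh, hle⟩
    obtain ⟨g, hg⟩ := hh.solvesDP
    by_contra! hm
    exact hle.not_gt ((hg.decision ha hh.1 hω hA hb).1 hm)
  · intro w hw
    obtain ⟨m, h1, h2⟩ := exists_between hw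
    exact ⟨m, hmem m h1, h2⟩

lemma index_eq_div_mul {B A b v N D : ℝ} (hN : A - v = N) (hD : 1 + A - b = D) :
    B * (A - v) / (1 + A - b) = N / D * B := by
  rw [hN, hD]; ring

/-! ### The stopping payoffs at `p01` and `p11` -/

lemma waitCost_of_stationary_le (ha : a.NoAbsorbingState) {ω : ℝ} (h : a.stationary ≤ ω) :
    a.waitCost ω = 0 := by
  refine max_eq_right ?_
  rw [T_sub_self ha]
  exact mul_nonpos_of_nonpos_of_nonneg (sub_nonpos.2 h) (sub_nonneg.2 ha.corr_lt_one.le)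

lemma waitCost_of_le_stationary (ha : a.NoAbsorbingState) {ω : ℝ} (h : ω ≤ a.stationary) :
    a.waitCost ω = a.T ω - ω := by
  refine max_eq_left ?_
  rw [T_sub_self ha]
  exact mul_nonneg (sub_nonneg.2 h) (sub_nonneg.2 ha.corr_lt_one.le)

lemma isGreatest_stopPayoffs_zero {ω x : ℝ} (j : ℕ)
    (h : ∀ k, a.T^[k] x ≤ max (a.T^[j] x) ω) :
    IsGreatest (a.stopPayoffs 0 ω x) (max (a.T^[j] x) ω) := by
  constructor
  · rcases max_choice (a.T^[j] x) ω with h1 | h1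
    · exact Or.inl ⟨j, by rw [h1]; simp⟩
    · exact Or.inr ⟨rfl, h1⟩
  · rintro y (⟨k, rfl⟩ | ⟨-, rfl⟩)
    · simpa using h k
    · exact le_max_right _ _

lemma T_sub_self_le (ha : a.NoAbsorbingState) {x ω : ℝ} (h : ω ≤ x) :
    a.T x - x ≤ a.T ω - ω := by
  rw [T_sub_self ha, T_sub_self ha]
  exact mul_le_mul_of_nonneg_right (sub_le_sub_left h _) (sub_nonneg.2 ha.corr_lt_one.le)

/-- Below the stationary belief it is optimal to stop as soon as the threshold is reached. -/
lemma isGreatest_stopPayoffs_of_crossing (ha : a.NoAbsorbingState) {ω : ℝ}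
    (hω : ω ≤ a.stationary) (L : ℕ) : ∀ x : ℝ, (∀ j < L, a.T^[j] x ≤ ω) → ω ≤ a.T^[L] x →
      IsGreatest (a.stopPayoffs (a.T ω - ω) ω x) (a.T^[L] x - L * (a.T ω - ω)) := by
  have hv : 0 ≤ a.T ω - ω := by
    rw [← waitCost_of_le_stationary ha hω]; exact a.waitCost_nonneg ω
  induction L with
  | zero =>
    intro x _ hx
    rw [Function.iterate_zero, id] at hx
    refine ⟨Or.inl ⟨0, rfl⟩, ?_⟩
    simp only [Function.iterate_zero, id, Nat.cast_zero, zero_mul, sub_zero]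
    rintro y (⟨k, rfl⟩ | ⟨-, rfl⟩)
    -- The drift `T x - x` decreases in `x`, so from `x ≥ ω` no step repays the cost `T ω - ω`.
    · have hk := Nat.cast_nonneg (α := ℝ) k
      rcases le_total a.stationary x with h1 | h1
      · have := iterate_T_le_of_stationary_le ha h1 k
        have := mul_nonneg hk hv
        linarith
      · have h2 := iterate_T_sub_le ha h1 k
        have h3 := mul_le_mul_of_nonneg_left (T_sub_self_le ha hx) hk
        linarith
    · exact hx
  | succ L ih =>
    intro x hlt hx
    have hg := ih (a.T x) (fun j hj => by
      rw [← Function.iterate_succ_apply]; exact hlt _ (Nat.succ_lt_succ hj))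
      (by rwa [← Function.iterate_succ_apply])
    rw [← Function.iterate_succ_apply] at hg
    refine ⟨Or.inl ⟨L + 1, rfl⟩, ?_⟩
    push_cast
    rintro y (⟨k, rfl⟩ | ⟨h0, rfl⟩)
    · cases k with
      | zero =>
        -- Stopping at once at `x ≤ ω` is no better: there the next step gains at least its cost.
        have h1 := hg.2 (Or.inl ⟨0, rfl⟩)
        have h2 := T_sub_self_le ha (hlt 0 (Nat.succ_pos L))
        simp only [Function.iterate_zero, id, Nat.cast_zero, zero_mul, sub_zero] at h1 h2 ⊢
        linarith
      | succ k =>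
        have h1 := hg.2 (Or.inl ⟨k, rfl⟩)
        rw [← Function.iterate_succ_apply] at h1
        push_cast
        linarith
    · have h1 := hg.2 (Or.inr ⟨h0, rfl⟩)
      rw [h0] at h1 ⊢
      linarith

lemma isGreatest_stopPayoffs_self (ha : a.NoAbsorbingState) {ω x : ℝ} (hω : ω ≤ a.stationary)
    (hx : ω ≤ x) : IsGreatest (a.stopPayoffs (a.waitCost ω) ω x) x := by
  have := isGreatest_stopPayoffs_of_crossing ha hω 0 x (fun j hj => absurd hj (Nat.not_lt_zero j)) hx
  rw [waitCost_of_le_stationary ha hω]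
  simpa using this

lemma isGreatest_stopPayoffs_max (ha : a.NoAbsorbingState) {ω x : ℝ} (hω : a.stationary ≤ ω)
    (hx : a.stationary ≤ x) : IsGreatest (a.stopPayoffs (a.waitCost ω) ω x) (max x ω) := by
  rw [waitCost_of_stationary_le ha hω]
  exact isGreatest_stopPayoffs_zero 0 fun k =>
    (iterate_T_le_of_stationary_le ha hx k).trans (le_max_left _ _)

lemma p01_sub_stationary (ha : a.NoAbsorbingState) :
    a.p01 - a.stationary = (a.p01 - a.p11) * a.stationary := by
  linear_combination - stationary_mul ha

lemma p11_sub_stationary (ha : a.NoAbsorbingState) :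
    a.p11 - a.stationary = (a.p11 - a.p01) * (1 - a.stationary) := by
  linear_combination - stationary_mul ha

/-! #### Positively correlated arms -/

lemma p01_le_stationary (ha : a.NoAbsorbingState) (hc : a.p01 ≤ a.p11) :
    a.p01 ≤ a.stationary := by
  have h1 := p01_sub_stationary ha
  have h2 := mul_nonneg (sub_nonneg.2 hc) (stationary_mem ha).1
  linarith

lemma stationary_le_p11 (ha : a.NoAbsorbingState) (hc : a.p01 ≤ a.p11) :
    a.stationary ≤ a.p11 := by
  have h1 := p11_sub_stationary ha
  have h2 := mul_nonneg (sub_nonneg.2 hc) (sub_nonneg.2 (stationary_mem ha).2)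
  linarith

/-- The orbit of `p01` stays below the stationary belief, so never stopping, which pays `ω`, is
best. -/
lemma isGreatest_stopPayoffs_p01_pos (ha : a.NoAbsorbingState) (hc : a.p01 ≤ a.p11) {ω : ℝ}
    (hω : a.stationary ≤ ω) : IsGreatest (a.stopPayoffs (a.waitCost ω) ω a.p01) ω := by
  have hp := p01_le_stationary ha hc
  have := isGreatest_stopPayoffs_zero (a := a) (ω := ω) (x := a.p01) 0 fun k => by
    refine le_max_of_le_right (le_trans ?_ hω)
    have h1 := iterate_T_sub_stationary ha a.p01 k
    have h2 := mul_nonneg (pow_nonneg (sub_nonneg.2 hc) k) (sub_nonneg.2 hp)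
    linarith
  rw [waitCost_of_stationary_le ha hω]
  rwa [Function.iterate_zero, id, max_eq_right (hp.trans hω)] at this

lemma isGreatest_stopPayoffs_crossingTime (ha : a.NoAbsorbingState) (hc : a.p01 ≤ a.p11) {ω : ℝ}
    (hω : ω < a.stationary) : IsGreatest (a.stopPayoffs (a.waitCost ω) ω a.p01)
      (a.T^[a.crossingTime a.p01 ω] a.p01 - a.crossingTime a.p01 ω * (a.T ω - ω)) := by
  have hd : |a.p11 - a.p01| < 1 := by
    rw [abs_of_nonneg (sub_nonneg.2 hc)]; exact ha.corr_lt_one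
  have hne : {k : ℕ | ω < a.T^[k] a.p01}.Nonempty :=
    ((tendsto_iterate_T ha hd continuousOn_id a.p01_mem).eventually_const_lt hω).exists
  rw [waitCost_of_le_stationary ha hω.le]
  exact isGreatest_stopPayoffs_of_crossing ha hω.le _ _
    (fun j hj => not_lt.1 (Nat.notMem_of_lt_sInf hj)) (Nat.sInf_mem hne).le

/-! #### Negatively correlated arms -/

lemma stationary_le_p01 (ha : a.NoAbsorbingState) (hc : a.p11 ≤ a.p01) :
    a.stationary ≤ a.p01 := by
  have h1 := p01_sub_stationary ha
  have h2 := mul_nonneg (sub_nonneg.2 hc) (stationary_mem ha).1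
  linarith

lemma p11_le_stationary (ha : a.NoAbsorbingState) (hc : a.p11 ≤ a.p01) :
    a.p11 ≤ a.stationary := by
  have h1 := p11_sub_stationary ha
  have h2 := mul_nonneg (sub_nonneg.2 hc) (sub_nonneg.2 (stationary_mem ha).2)
  linarith

lemma stationary_le_T_p11 (ha : a.NoAbsorbingState) (hc : a.p11 ≤ a.p01) :
    a.stationary ≤ a.T a.p11 := by
  have h1 := T_sub_T (a := a) a.p11 a.stationary
  rw [T_stationary ha] at h1
  have h2 := mul_nonneg (sub_nonneg.2 hc) (sub_nonneg.2 (p11_le_stationary ha hc))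
  linarith

lemma T_p11_le_p01 (hc : a.p11 ≤ a.p01) : a.T a.p11 ≤ a.p01 := by
  have h2 := mul_nonneg (sub_nonneg.2 hc) a.p11_mem.1
  unfold T
  linarith

/-- The orbit of `p11` oscillates about the stationary belief and peaks after one step. -/
lemma isGreatest_stopPayoffs_p11_neg (ha : a.NoAbsorbingState) (hc : a.p11 ≤ a.p01) {ω : ℝ}
    (hω : a.stationary ≤ ω) :
    IsGreatest (a.stopPayoffs (a.waitCost ω) ω a.p11) (max (a.T a.p11) ω) := by
  rw [waitCost_of_stationary_le ha hω]
  have h1 := stationary_le_T_p11 ha hc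
  refine isGreatest_stopPayoffs_zero 1 fun k => le_max_of_le_left ?_
  cases k with
  | zero => exact (p11_le_stationary ha hc).trans h1
  | succ k =>
    rw [Function.iterate_succ_apply]
    exact iterate_T_le_of_stationary_le ha h1 k

lemma isGreatest_stopPayoffs_p11_neg' (ha : a.NoAbsorbingState) (hc : a.p11 ≤ a.p01) {ω : ℝ}
    (hq : a.p11 ≤ ω) (hω : ω ≤ a.stationary) :
    IsGreatest (a.stopPayoffs (a.waitCost ω) ω a.p11) (a.T a.p11 - (a.T ω - ω)) := by
  have := isGreatest_stopPayoffs_of_crossing ha hω 1 a.p11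
    (fun j hj => by rw [Nat.lt_one_iff.1 hj]; exact hq) (hω.trans (stationary_le_T_p11 ha hc))
  rw [waitCost_of_le_stationary ha hω]
  simpa using this

lemma exists_isGreatest_stopPayoffs (ha : a.NoAbsorbingState) (ω : ℝ) :
    ∃ A b, IsGreatest (a.stopPayoffs (a.waitCost ω) ω a.p01) A ∧
      IsGreatest (a.stopPayoffs (a.waitCost ω) ω a.p11) b := by
  rcases le_total a.p01 a.p11 with hc | hc
  · have hq := stationary_le_p11 ha hc
    rcases lt_or_ge ω a.stationary with hω | hω
    · exact ⟨_, _, isGreatest_stopPayoffs_crossingTime ha hc hω,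
        isGreatest_stopPayoffs_self ha hω.le (hω.le.trans hq)⟩
    · exact ⟨_, _, isGreatest_stopPayoffs_p01_pos ha hc hω, isGreatest_stopPayoffs_max ha hω hq⟩
  · have hp := stationary_le_p01 ha hc
    rcases le_total ω a.stationary with hω | hω
    · rcases le_total ω a.p11 with hωq | hωq
      · exact ⟨_, _, isGreatest_stopPayoffs_self ha hω (hω.trans hp),
          isGreatest_stopPayoffs_self ha hω hωq⟩
      · exact ⟨_, _, isGreatest_stopPayoffs_self ha hω (hω.trans hp),
          isGreatest_stopPayoffs_p11_neg' ha hc hωq hω⟩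
    · exact ⟨_, _, isGreatest_stopPayoffs_max ha hω hp, isGreatest_stopPayoffs_p11_neg ha hc hω⟩

/-! ### Indexability and the decision rule -/

lemma averageWhittleIndex_mem (ha : a.NoAbsorbingState) {ω : ℝ} (hω : ω ∈ Icc (0 : ℝ) 1) :
    a.averageWhittleIndex ω ∈ Icc 0 a.B := by
  obtain ⟨A, b, hA, hb⟩ := exists_isGreatest_stopPayoffs ha ω
  obtain ⟨hD, hN, hND⟩ := ratio_bounds ha hω hA hb
  rw [averageWhittleIndex_eq ha hω hA hb]
  exact ⟨div_nonneg (mul_nonneg a.B_pos.le hN) hD.le,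
    (div_le_iff₀ hD).2 (mul_le_mul_of_nonneg_left hND a.B_pos.le)⟩

lemma SolvesDP.decision_index {m g ω : ℝ} {h : ℝ → ℝ} (ha : a.NoAbsorbingState)
    (hV : a.SolvesDP 1 m g h) (hc : ContinuousOn h (Icc 0 1)) (hω : ω ∈ Icc (0 : ℝ) 1) :
    (m < a.averageWhittleIndex ω → a.averagePassive m h ω < a.averageActive h ω) ∧
    (a.averageWhittleIndex ω < m → a.averageActive h ω ≤ a.averagePassive m h ω) ∧
    (a.averageWhittleIndex ω < m → m < a.B →
      a.averageActive h ω < a.averagePassive m h ω) := by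
  obtain ⟨A, b, hA, hb⟩ := exists_isGreatest_stopPayoffs ha ω
  rw [averageWhittleIndex_eq ha hω hA hb]
  exact hV.decision ha hc hω hA hb

lemma mem_averagePassiveSet_of_lt (ha : a.NoAbsorbingState) {ω m : ℝ} (hω : ω ∈ Icc (0 : ℝ) 1)
    (hm : a.averageWhittleIndex ω < m) : ω ∈ a.averagePassiveSet m := by
  obtain ⟨h, hh⟩ := exists_isRelativeValue ha m
  obtain ⟨g, hg⟩ := hh.solvesDP
  exact ⟨hω, h, hh, (hg.decision_index ha hh.1 hω).2.1 hm⟩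

lemma averageWhittleIndex_le_of_mem (ha : a.NoAbsorbingState) {ω m : ℝ}
    (h : ω ∈ a.averagePassiveSet m) : a.averageWhittleIndex ω ≤ m := by
  obtain ⟨hω, h, hh, hle⟩ := h
  obtain ⟨g, hg⟩ := hh.solvesDP
  by_contra! hm
  exact hle.not_gt ((hg.decision_index ha hh.1 hω).1 hm)

lemma NoAbsorbingState.averageIndexable (ha : a.NoAbsorbingState) : a.AverageIndexable := by
  -- The decision is not settled at a subsidy equal to the index; monotonicity needs only the strict
  -- comparison `m < m'`.
  refine ⟨fun m m' hmm ω hω => ?_, ?_, ?_⟩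
  · rcases hmm.lt_or_eq with h | rfl
    · exact mem_averagePassiveSet_of_lt ha hω.1 ((averageWhittleIndex_le_of_mem ha hω).trans_lt h)
    · exact hω
  · filter_upwards [eventually_lt_atBot 0] with m hm
    refine eq_empty_of_forall_notMem fun ω hω => ?_
    exact hm.not_ge ((averageWhittleIndex_mem ha hω.1).1.trans (averageWhittleIndex_le_of_mem ha hω))
  · filter_upwards [eventually_gt_atTop a.B] with m hm
    exact Subset.antisymm (fun ω hω => hω.1) fun ω hω =>
      mem_averagePassiveSet_of_lt ha hω ((averageWhittleIndex_mem ha hω).2.trans_lt hm)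

/-! ### The index as a limit of discounted indices -/

lemma exists_ultrafilter_of_frequently {X : Type*} {F : Filter X} {p : X → Prop}
    (h : ∃ᶠ x in F, p x) : ∃ U : Ultrafilter X, (U : Filter X) ≤ F ∧ ∀ᶠ x in (U : Filter X), p x := by
  have := frequently_iff_neBot.1 h
  have hU := Ultrafilter.of_le (F ⊓ 𝓟 {x | p x})
  exact ⟨_, hU.trans inf_le_left, le_principal_iff.1 (hU.trans inf_le_right)⟩

/-- For `m < B` passive is strictly better in the limit, which excludes discounted activity for `β`
arbitrarily near `1`. For `m ≥ B` passivity holds for each `β` directly. -/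
lemma eventually_mem_discountedPassiveSet (ha : a.NoAbsorbingState) {ω m : ℝ}
    (hω : ω ∈ Icc (0 : ℝ) 1) (hm : a.averageWhittleIndex ω < m) :
    ∀ᶠ β in 𝓝[<] (1 : ℝ), ω ∈ a.discountedPassiveSet β m := by
  rcases le_or_gt a.B m with hB | hB
  · filter_upwards [Ioo_mem_nhdsLT (zero_lt_one (α := ℝ))] with β h
    exact mem_discountedPassiveSet_of_le h.1.le h.2 hB hω
  · by_contra hcon
    obtain ⟨U, hU, hp⟩ := exists_ultrafilter_of_frequently (not_eventually.1 hcon)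
    obtain ⟨g, h, hV, hc, hd⟩ := exists_solvesDP_of_tendsto ha hU (tendsto_const_nhds (x := m))
    have h1 := (hd ω hω).2 (hp.mono fun β hβ => by
      by_contra! h2
      exact hβ ⟨hω, h2.le⟩)
    exact h1.not_gt ((hV.decision_index ha hc hω).2.2 hm hB)

/-- Offending subsidies may vary with `β`, but they lie in `[0, l]` and so converge along the
ultrafilter to some `m ≤ l`, where the limit decision contradicts `l < W(ω)`. -/
lemma eventually_forall_mem_discountedPassiveSet (ha : a.NoAbsorbingState) {ω l : ℝ}
    (hω : ω ∈ Icc (0 : ℝ) 1) (hl : l < a.averageWhittleIndex ω) :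
    ∀ᶠ β in 𝓝[<] (1 : ℝ), ∀ m, ω ∈ a.discountedPassiveSet β m → l < m := by
  by_contra hcon
  obtain ⟨U, hU, hp⟩ := exists_ultrafilter_of_frequently (not_eventually.1 hcon)
  have hex : ∀ β : ℝ, ∃ m, (¬ ∀ m, ω ∈ a.discountedPassiveSet β m → l < m) →
      ω ∈ a.discountedPassiveSet β m ∧ m ≤ l := by
    intro β
    by_cases h : ∀ m, ω ∈ a.discountedPassiveSet β m → l < m
    -- The value `0` is a filler where no offending subsidy exists.
    · exact ⟨0, fun h' => absurd h h'⟩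
    · push Not at h
      obtain ⟨m, hm⟩ := h
      exact ⟨m, fun _ => hm⟩
  choose μ hμ using hex
  have hβ : ∀ᶠ β in (U : Filter ℝ), 0 ≤ β ∧ β < 1 := by
    refine hU ?_
    filter_upwards [Ioo_mem_nhdsLT (zero_lt_one (α := ℝ))] with β h using ⟨h.1.le, h.2⟩
  obtain ⟨m, hm⟩ := exists_tendsto_of_eventually_abs_le (U := U) (F := μ) (K := l) (by
    filter_upwards [hp, hβ] with β h1 h2
    obtain ⟨h3, h4⟩ := hμ β h1
    rwa [abs_of_nonneg (nonneg_of_mem_discountedPassiveSet h2.1 h2.2 h3)])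
  obtain ⟨g, h, hV, hc, hd⟩ := exists_solvesDP_of_tendsto ha hU hm
  have h1 := (hd ω hω).1 (hp.mono fun β hβ => (hμ β hβ).1.2)
  have h2 : m ≤ l := le_of_tendsto hm (hp.mono fun β hβ => (hμ β hβ).2)
  exact h1.not_gt ((hV.decision_index ha hc hω).1 (h2.trans_lt hl))

lemma tendsto_discountedWhittleIndex (ha : a.NoAbsorbingState) {ω : ℝ}
    (hω : ω ∈ Icc (0 : ℝ) 1) :
    Tendsto (fun β : ℝ => a.discountedWhittleIndex β ω) (𝓝[<] 1)
      (𝓝 (a.averageWhittleIndex ω)) := by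
  have hβ : ∀ᶠ β in 𝓝[<] (1 : ℝ), 0 ≤ β ∧ β < 1 := by
    filter_upwards [Ioo_mem_nhdsLT (zero_lt_one (α := ℝ))] with β h using ⟨h.1.le, h.2⟩
  refine tendsto_order.2 ⟨fun l hl => ?_, fun u hu => ?_⟩
  · obtain ⟨l', h1, h2⟩ := exists_between hl
    filter_upwards [hβ, eventually_forall_mem_discountedPassiveSet ha hω h2] with β h3 h4
    exact h1.trans_le (le_csInf
      ⟨a.B, mem_discountedPassiveSet_of_le h3.1 h3.2 le_rfl hω⟩ fun m hm => (h4 m hm).le)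
  · obtain ⟨m, h1, h2⟩ := exists_between hu
    filter_upwards [hβ, eventually_mem_discountedPassiveSet ha hω h1] with β h3 h4
    exact (csInf_le ⟨0, fun m hm => nonneg_of_mem_discountedPassiveSet h3.1 h3.2 hm⟩ h4).trans_lt h2

/-! ### Explicit formulas -/

/-- Both orbits stop at once, and `p01 - (T ω - ω) = ω (1 - (p11 - p01))` cancels the denominator.
-/
lemma averageWhittleIndex_of_le (ha : a.NoAbsorbingState) {ω : ℝ} (hω : ω ∈ Icc (0 : ℝ) 1)
    (hp : ω ≤ a.p01) (hq : ω ≤ a.p11) (hs : ω ≤ a.stationary) :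
    a.averageWhittleIndex ω = ω * a.B := by
  have hd := (sub_pos.2 ha.corr_lt_one).ne'
  rw [averageWhittleIndex_eq ha hω (isGreatest_stopPayoffs_self ha hs hp)
    (isGreatest_stopPayoffs_self ha hs hq), waitCost_of_le_stationary ha hs,
    index_eq_div_mul (N := ω * (1 - (a.p11 - a.p01))) (D := 1 - (a.p11 - a.p01))
      (by unfold T; ring) (by ring), mul_div_cancel_right₀ _ hd]

lemma averageWhittleIndex_pos (ha : a.NoAbsorbingState) (hc : a.p01 ≤ a.p11) {ω : ℝ}
    (hω : ω ∈ Icc (0 : ℝ) 1) (hs : a.stationary ≤ ω) :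
    a.averageWhittleIndex ω = ω / (1 + ω - max a.p11 ω) * a.B := by
  rw [averageWhittleIndex_eq ha hω (isGreatest_stopPayoffs_p01_pos ha hc hs)
    (isGreatest_stopPayoffs_max ha hs (stationary_le_p11 ha hc)), waitCost_of_stationary_le ha hs]
  exact index_eq_div_mul (by ring) rfl

lemma averageWhittleIndex_neg (ha : a.NoAbsorbingState) (hc : a.p11 ≤ a.p01) {ω : ℝ}
    (hω : ω ∈ Icc (0 : ℝ) 1) (hs : a.stationary ≤ ω) :
    a.averageWhittleIndex ω =
      max a.p01 ω / (1 + max a.p01 ω - max (a.T a.p11) ω) * a.B := by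
  rw [averageWhittleIndex_eq ha hω (isGreatest_stopPayoffs_max ha hs (stationary_le_p01 ha hc))
    (isGreatest_stopPayoffs_p11_neg ha hc hs), waitCost_of_stationary_le ha hs]
  exact index_eq_div_mul (by ring) rfl

end Arm

theorem theorem4 {N : ℕ} (X : RMBP N) (hX : ∀ i, (X.arm i).NoAbsorbingState) :
    -- relative value functions exist, for every arm and every subsidy
    (∀ (i : Fin N) (m : ℝ), ∃ h : ℝ → ℝ, (X.arm i).IsRelativeValue m h) ∧
    -- indexability
    X.AverageIndexable ∧
    -- the decision at `ω` does not depend on the choice of the relative value function, except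
    -- possibly when the subsidy equals the index of `ω`
    (∀ (i : Fin N) (m : ℝ) (h : ℝ → ℝ), (X.arm i).IsRelativeValue m h →
      ∀ ω ∈ Icc (0 : ℝ) 1,
        (m < (X.arm i).averageWhittleIndex ω →
          (X.arm i).averagePassive m h ω < (X.arm i).averageActive h ω) ∧
        ((X.arm i).averageWhittleIndex ω < m →
          (X.arm i).averageActive h ω ≤ (X.arm i).averagePassive m h ω)) ∧
    -- the index is the limit of the discounted indices
    (∀ (i : Fin N), ∀ ω ∈ Icc (0 : ℝ) 1,
      Tendsto (fun β : ℝ => (X.arm i).discountedWhittleIndex β ω) (𝓝[<] 1)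
        (𝓝 ((X.arm i).averageWhittleIndex ω))) ∧
    -- positively correlated arms
    (∀ i : Fin N, (X.arm i).p01 ≤ (X.arm i).p11 → ∀ ω ∈ Icc (0 : ℝ) 1,
      (ω ≤ (X.arm i).p01 ∨ (X.arm i).p11 ≤ ω →
        (X.arm i).averageWhittleIndex ω = ω * (X.arm i).B) ∧
      ((X.arm i).p01 < ω → ω < (X.arm i).stationary →
        (X.arm i).averageWhittleIndex ω =
          ((ω - (X.arm i).T ω) * (((X.arm i).crossingTime (X.arm i).p01 ω : ℝ) + 1)
              + (X.arm i).T^[(X.arm i).crossingTime (X.arm i).p01 ω] (X.arm i).p01)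
            / (1 - (X.arm i).p11
              + (ω - (X.arm i).T ω) * ((X.arm i).crossingTime (X.arm i).p01 ω : ℝ)
              + (X.arm i).T^[(X.arm i).crossingTime (X.arm i).p01 ω] (X.arm i).p01)
            * (X.arm i).B) ∧
      ((X.arm i).stationary ≤ ω → ω < (X.arm i).p11 →
        (X.arm i).averageWhittleIndex ω = ω / (1 - (X.arm i).p11 + ω) * (X.arm i).B)) ∧
    -- negatively correlated arms
    (∀ i : Fin N, (X.arm i).p11 < (X.arm i).p01 → ∀ ω ∈ Icc (0 : ℝ) 1,
      (ω ≤ (X.arm i).p11 ∨ (X.arm i).p01 ≤ ω →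
        (X.arm i).averageWhittleIndex ω = ω * (X.arm i).B) ∧
      ((X.arm i).p11 < ω → ω < (X.arm i).stationary →
        (X.arm i).averageWhittleIndex ω =
          (ω + (X.arm i).p01 - (X.arm i).T ω)
            / (1 + (X.arm i).p01 - (X.arm i).T (X.arm i).p11 + (X.arm i).T ω - ω)
            * (X.arm i).B) ∧
      ((X.arm i).stationary ≤ ω → ω < (X.arm i).T (X.arm i).p11 →
        (X.arm i).averageWhittleIndex ω =
          (X.arm i).p01 / (1 + (X.arm i).p01 - (X.arm i).T (X.arm i).p11) * (X.arm i).B) ∧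
      ((X.arm i).T (X.arm i).p11 ≤ ω → ω < (X.arm i).p01 →
        (X.arm i).averageWhittleIndex ω =
          (X.arm i).p01 / (1 + (X.arm i).p01 - ω) * (X.arm i).B)) := by
  refine ⟨fun i m => Arm.exists_isRelativeValue (hX i) m, fun i => (hX i).averageIndexable,
    fun i m h hh ω hω => ?_, fun i ω hω => Arm.tendsto_discountedWhittleIndex (hX i) hω,
    fun i hc ω hω => ⟨?_, fun h1 h2 => ?_, fun h1 h2 => ?_⟩,
    fun i hc ω hω => ⟨?_, fun h1 h2 => ?_, fun h1 h2 => ?_, fun h1 h2 => ?_⟩⟩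
  · obtain ⟨g, hg⟩ := hh.solvesDP
    have := hg.decision_index (hX i) hh.1 hω
    exact ⟨this.1, this.2.1⟩
  · rintro (h | h)
    · exact Arm.averageWhittleIndex_of_le (hX i) hω h (h.trans hc)
        (h.trans (Arm.p01_le_stationary (hX i) hc))
    · rw [Arm.averageWhittleIndex_pos (hX i) hc hω ((Arm.stationary_le_p11 (hX i) hc).trans h),
        max_eq_right h, add_sub_cancel_right, div_one]
  · rw [Arm.averageWhittleIndex_eq (hX i) hω (Arm.isGreatest_stopPayoffs_crossingTime (hX i) hc h2)
      (Arm.isGreatest_stopPayoffs_self (hX i) h2.le (h2.le.trans (Arm.stationary_le_p11 (hX i) hc))),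
      Arm.waitCost_of_le_stationary (hX i) h2.le]
    exact Arm.index_eq_div_mul (by ring) (by ring)
  · rw [Arm.averageWhittleIndex_pos (hX i) hc hω h1, max_eq_left h2.le, add_sub_right_comm]
  · rintro (h | h)
    · exact Arm.averageWhittleIndex_of_le (hX i) hω (h.trans hc.le) h
        (h.trans (Arm.p11_le_stationary (hX i) hc.le))
    · rw [Arm.averageWhittleIndex_neg (hX i) hc.le hω
        ((Arm.stationary_le_p01 (hX i) hc.le).trans h), max_eq_right h,
        max_eq_right ((Arm.T_p11_le_p01 hc.le).trans h), add_sub_cancel_right, div_one]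
  · rw [Arm.averageWhittleIndex_eq (hX i) hω
      (Arm.isGreatest_stopPayoffs_self (hX i) h2.le
        (h2.le.trans (Arm.stationary_le_p01 (hX i) hc.le)))
      (Arm.isGreatest_stopPayoffs_p11_neg' (hX i) hc.le h1.le h2.le),
      Arm.waitCost_of_le_stationary (hX i) h2.le]
    exact Arm.index_eq_div_mul (by ring) (by ring)
  -- Below `T p11` neither maximum depends on `ω`, hence the plateau.
  · rw [Arm.averageWhittleIndex_neg (hX i) hc.le hω h1, max_eq_left h2.le,
      max_eq_left (h2.le.trans (Arm.T_p11_le_p01 hc.le))]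
  · rw [Arm.averageWhittleIndex_neg (hX i) hc.le hω
      ((Arm.stationary_le_T_p11 (hX i) hc.le).trans h1), max_eq_left h2.le, max_eq_right h1]
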